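/- Let $p$ be an odd prime, let $\zeta_2$ be a primitive $p^2$-th root of unity, $\zeta_1=\zeta_2^p$, $\mathbb K=\mathbb Q(\zeta_1)$, and let $C$ be a cyclic group of order $p^2$. Let $F=\mathbb Z[\zeta_1]/(p)$, let $j_1:\mathbb Z[\zeta_1]\to F$ be the quotient map, let $j_2:\mathbb Z[\zeta_2]\to F$ be the ring homomorphism with $j_2(\zeta_2)=j_1(\zeta_1)$, and let $A=\{(a_1,a_2)\in\mathbb Z[\zeta_1]\times\mathbb Z[\zeta_2] : j_1(a_1)=j_2(a_2)\}$. An ideal $\alpha$ is called prime to $p$ if $\alpha+(p)=(1)$. For ideals $\alpha_k\subseteq\mathbb Z[\zeta_k]$ prime to $p$ ($k=1,2$) and a unit $h\in F^\times$ let $$M(\alpha_1,\alpha_2,h)=\{(a_1,a_2)\in\alpha_1\times\alpha_2 : j_1(a_1)=h\,j_2(a_2)\},$$ which is an invertible $A$-module. The ring homomorphism $\mathbb ZC\to A$ sending a generator of $C$ to $(\zeta_1,\zeta_2)$ induces an isomorphism $\mathrm{Pic}(\mathbb ZC)\cong\mathrm{Pic}(A)$. There is a homomorphism $\psi:Cl(\mathbb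 Z[\zeta_2])\to\mathrm{Pic}(A)$ with $\psi([\alpha])=[M(N\alpha,\alpha,1)]$ for all ideals $\alpha$ prime to $p$, where $N$ is the ideal norm from $\mathbb Z[\zeta_2]$ to $\mathbb Z[\zeta_1]$. It splits the canonical projection $\mathrm{Pic}(A)\to \mathrm{Pic}(\mathbb Z[\zeta_2])=Cl(\mathbb Z[\zeta_2])$. Let $B$ be the kernel of this projection, so that $\mathrm{Pic}(A)=\psi(Cl(\mathbb Z[\zeta_2]))\oplus B$; it consists of the classes of the modules $M(\alpha,\mathbb Z[\zeta_2],h)$ with $\alpha$ an ideal of $\mathbb Z[\zeta_1]$ prime to $p$ and $h\in F^\times$. Let $I_0(\mathbb K)$ be the group of fractional ideals of $\mathbb K$ prime to $p$, and let $H\subseteq I_0(\mathbb K)$ be the subgroup of the principal fractional ideals that have a generator $g\equiv 1 \bmod p$, that is, $g=x/y$ with $x,y\in\mathbb Z[\zeta_1]$, $y$ prime to $p$ and $x\equiv y\bmod p$. **Theorem 2.1.** The map sending the class of $M(\alpha,\mathbb Z[\zeta_2],h)$ to the class of $h^{-1}\alpha$, that is, of $(x)^{-1}\alpha$ for any $x\in\mathbb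 Z[\zeta_1]$ with $j_1(x)=h$, is a well-defined group isomorphism $B\cong I_0(\mathbb K)/H$, and it restricts to an isomorphism $B_p\cong (I_0(\mathbb K)/H)_p$ of the Sylow $p$-subgroups. -/

import Mathlib

open NumberField CommRing
open scoped nonZeroDivisors

noncomputable section

namespace CyclicPic

/-! ### The rings -/

section Rings

variable (p : ℕ) [Fact p.Prime]

/-- The ideal `(p)` of a commutative ring `R`. -/
abbrev pIdeal (R : Type*) [CommRing R] : Ideal R := Ideal.span {(p : R)}

/-- The local ring `F = ℤ[ζ₁]/(p)`, where `ℤ[ζ₁] = 𝓞 K`. -/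
abbrev F (K : Type*) [Field K] [NumberField K] : Type _ := 𝓞 K ⧸ pIdeal p (𝓞 K)

/-- The canonical map `j₁ : ℤ[ζ₁] → F`. -/
abbrev j₁ (K : Type*) [Field K] [NumberField K] : 𝓞 K →+* F p K :=
  Ideal.Quotient.mk (pIdeal p (𝓞 K))

variable {p}
variable {K : Type*} [Field K] [NumberField K]
variable {L : Type*} [Field L] [NumberField L] [IsCyclotomicExtension {p ^ 2} ℚ L]
variable {ζ₁ : K} (h₁ : IsPrimitiveRoot ζ₁ p) {ζ₂ : L} (h₂ : IsPrimitiveRoot ζ₂ (p ^ 2))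

theorem aeval_minpoly_eq_zero :
    Polynomial.aeval (j₁ p K h₁.toInteger)
      (minpoly ℤ h₂.integralPowerBasisOfPrimePow.gen) = 0 := by
  have hgen : minpoly ℤ h₂.integralPowerBasisOfPrimePow.gen =
      Polynomial.cyclotomic (p ^ 2) ℤ := by
    rw [Polynomial.cyclotomic_eq_minpoly h₂ (NeZero.pos _), h₂.integralPowerBasisOfPrimePow_gen]
    exact (minpoly.algebraMap_eq (B' := L) RingOfIntegers.coe_injective h₂.toInteger).symm
  have hone : h₁.toInteger ^ p = 1 := h₁.toInteger_isPrimitiveRoot.pow_eq_one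
  rw [hgen, Polynomial.cyclotomic_prime_pow_eq_geom_sum (Fact.out : p.Prime)]
  simp only [pow_one, map_sum, map_pow, Polynomial.aeval_X]
  simp only [← map_pow, hone, map_one, one_pow, Finset.sum_const, Finset.card_range, nsmul_eq_mul,
    mul_one]
  rw [← map_natCast (Ideal.Quotient.mk (pIdeal p (𝓞 K))), Ideal.Quotient.eq_zero_iff_mem]
  exact Ideal.mem_span_singleton_self _

/-- The canonical map `j₂ : ℤ[ζ₂] → F`, the ring homomorphism that sends `ζ₂` to the class
of `ζ₁`. -/
def j₂ : 𝓞 L →+* F p K :=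
  (h₂.integralPowerBasisOfPrimePow.lift (j₁ p K h₁.toInteger)
    (aeval_minpoly_eq_zero h₁ h₂)).toRingHom

theorem j₂_toInteger : j₂ h₁ h₂ h₂.toInteger = j₁ p K h₁.toInteger := by
  have := h₂.integralPowerBasisOfPrimePow.lift_gen (j₁ p K h₁.toInteger)
    (aeval_minpoly_eq_zero h₁ h₂)
  rwa [h₂.integralPowerBasisOfPrimePow_gen] at this

/-- The ring `A`, the Cartesian (fibre) product of `ℤ[ζ₁]` and `ℤ[ζ₂]` over `F`. -/
def A : Subring (𝓞 K × 𝓞 L) :=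
  RingHom.eqLocus ((j₁ p K).comp (RingHom.fst (𝓞 K) (𝓞 L)))
    ((j₂ h₁ h₂).comp (RingHom.snd (𝓞 K) (𝓞 L)))

theorem mem_A {x : 𝓞 K × 𝓞 L} : x ∈ A h₁ h₂ ↔ j₁ p K x.1 = j₂ h₁ h₂ x.2 := Iff.rfl

/-- The projection `A → ℤ[ζ₂]`. -/
def projTwo : A h₁ h₂ →+* 𝓞 L := (RingHom.snd (𝓞 K) (𝓞 L)).comp (A h₁ h₂).subtype

/-- The element `(ζ₁, ζ₂)` of `A`. -/
def zetaPair : A h₁ h₂ := ⟨(h₁.toInteger, h₂.toInteger), (j₂_toInteger h₁ h₂).symm⟩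

theorem zetaPair_pow : zetaPair h₁ h₂ ^ (p ^ 2) = 1 := by
  apply Subtype.ext
  refine Prod.ext ?_ ?_
  · change h₁.toInteger ^ (p ^ 2) = 1
    rw [pow_two, pow_mul, h₁.toInteger_isPrimitiveRoot.pow_eq_one, one_pow]
  · change h₂.toInteger ^ (p ^ 2) = 1
    exact h₂.toInteger_isPrimitiveRoot.pow_eq_one

/-- The homomorphism from the cyclic group of order `n` that sends the generator to `a`,
where `a ^ n = 1`. -/
def cyclicHom {G : Type*} [Monoid G] (n : ℕ) [NeZero n] (a : G) (ha : a ^ n = 1) :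
    Multiplicative (ZMod n) →* G where
  toFun k := a ^ (Multiplicative.toAdd k).val
  map_one' := by simp
  map_mul' x y := by
    rw [toAdd_mul, ZMod.val_add, ← pow_add, ← pow_mod_orderOf,
      Nat.mod_mod_of_dvd _ (orderOf_dvd_of_pow_eq_one ha), pow_mod_orderOf]

/-- The integral group ring `ℤ C` of the cyclic group `C` of order `p ^ 2`. -/
abbrev GroupRing (p : ℕ) : Type := MonoidAlgebra ℤ (Multiplicative (ZMod (p ^ 2)))

/-- The canonical ring homomorphism `ℤ C → A` that sends the generator of `C` to `(ζ₁, ζ₂)`. -/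
def groupRingToA : GroupRing p →+* A h₁ h₂ :=
  (MonoidAlgebra.lift ℤ (A h₁ h₂) (Multiplicative (ZMod (p ^ 2)))
    (cyclicHom (p ^ 2) (zetaPair h₁ h₂) (zetaPair_pow h₁ h₂))).toRingHom

/-! ### Invertible modules over `A` -/

/-- The module `M(α₁, α₂, h)` for ideals `α₁`, `α₂` of `ℤ[ζ₁]`, `ℤ[ζ₂]` and a unit `h` of `F`:
the `A`-module of all `(a₁, a₂) ∈ α₁ × α₂` with `j₁ a₁ = h * j₂ a₂`.
If `α₁`, `α₂` are prime to `p`, then `j₁`, `j₂` identify `F ⊗ α₁`, `F ⊗ α₂` with `F`, and this is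
the module obtained by gluing `α₁` and `α₂` along multiplication by `h` on `F`. -/
def M (α₁ : Ideal (𝓞 K)) (α₂ : Ideal (𝓞 L)) (h : (F p K)ˣ) :
    Submodule (A h₁ h₂) (𝓞 K × 𝓞 L) where
  carrier := {x | x.1 ∈ α₁ ∧ x.2 ∈ α₂ ∧ j₁ p K x.1 = h * j₂ h₁ h₂ x.2}
  zero_mem' := by simp
  add_mem' := by
    rintro x y ⟨hx₁, hx₂, hx⟩ ⟨hy₁, hy₂, hy⟩
    refine ⟨add_mem hx₁ hy₁, add_mem hx₂ hy₂, ?_⟩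
    rw [Prod.fst_add, Prod.snd_add, map_add, map_add, hx, hy, mul_add]
  smul_mem' := by
    rintro c x ⟨hx₁, hx₂, hx⟩
    refine ⟨α₁.mul_mem_left c.1.1 hx₁, α₂.mul_mem_left c.1.2 hx₂, ?_⟩
    change j₁ p K (c.1.1 * x.1) = h * j₂ h₁ h₂ (c.1.2 * x.2)
    rw [map_mul, map_mul, hx, (mem_A h₁ h₂).1 c.2]
    ring

/-- `X` is the class of the `A`-module `P` in the Picard group of `A`. -/
def IsClassOf (X : Pic (A h₁ h₂)) (P : Submodule (A h₁ h₂) (𝓞 K × 𝓞 L)) : Prop :=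
  Nonempty (X ≃ₗ[A h₁ h₂] P)

/-- The subgroup `B` of `Pic A`, the kernel of the canonical projection `Pic A → Pic ℤ[ζ₂]`. -/
def B : Subgroup (Pic (A h₁ h₂)) := (Pic.mapRingHom (projTwo h₁ h₂)).ker

end Rings

/-! ### The ray class group -/

section Ray

/-- An integral ideal is prime to `p`. -/
def PrimeTo (p : ℕ) {R : Type*} [CommRing R] (I : Ideal R) : Prop := IsCoprime I (pIdeal p R)

theorem primeTo_top (p : ℕ) {R : Type*} [CommRing R] : PrimeTo p (1 : Ideal R) :=
  isCoprime_one_left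

theorem primeTo_span {p : ℕ} {K : Type*} [Field K] [NumberField K] {x : 𝓞 K} {h : (F p K)ˣ}
    (hx : j₁ p K x = h) :
    PrimeTo p (Ideal.span {x}) := by
  have hu : IsUnit (j₁ p K x) := hx ▸ h.isUnit
  obtain ⟨c, hc⟩ := hu.exists_left_inv
  obtain ⟨y, rfl⟩ := Ideal.Quotient.mk_surjective c
  rw [← map_mul, ← map_one (j₁ p K), Ideal.Quotient.eq, Ideal.mem_span_singleton'] at hc
  obtain ⟨a, ha⟩ := hc
  rw [PrimeTo, pIdeal, Ideal.isCoprime_span_singleton_iff]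
  exact ⟨y, -a, by linear_combination -ha⟩

variable (p : ℕ) [Fact p.Prime] (K : Type*) [Field K] [NumberField K]

variable {p K} in
theorem PrimeTo.ne_zero {I : Ideal (𝓞 K)} (hI : PrimeTo p I) :
    (I : FractionalIdeal (𝓞 K)⁰ K) ≠ 0 := by
  rintro h
  rw [FractionalIdeal.coeIdeal_eq_zero] at h
  subst h
  have hu : IsUnit ((p : ℤ) : ℤ) := by
    have h1 : IsUnit (pIdeal p (𝓞 K)) := isCoprime_zero_left.1 hI
    rw [Ideal.isUnit_iff, Ideal.span_singleton_eq_top] at h1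
    have h2 : IsUnit (algebraMap ℤ (𝓞 K) (p : ℤ)) := by simpa using h1
    exact isUnit_of_map_unit _ _ h2
  exact (Nat.prime_iff_prime_int.1 (Fact.out : p.Prime)).not_isUnit hu

variable {p K} in
/-- An integral ideal prime to `p`, as an invertible fractional ideal. -/
def PrimeTo.unit {I : Ideal (𝓞 K)} (hI : PrimeTo p I) : (FractionalIdeal (𝓞 K)⁰ K)ˣ :=
  Units.mk0 (I : FractionalIdeal (𝓞 K)⁰ K) hI.ne_zero

/-- The group `I₀(K)` of fractional ideals of `K` prime to `p`, that is, of all quotients of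
integral ideals prime to `p`. -/
def I₀ : Subgroup (FractionalIdeal (𝓞 K)⁰ K)ˣ where
  carrier := {J | ∃ (a b : Ideal (𝓞 K)) (ha : PrimeTo p a) (hb : PrimeTo p b),
    J = ha.unit / hb.unit}
  one_mem' := ⟨1, 1, primeTo_top p, primeTo_top p, by simp⟩
  mul_mem' := by
    rintro _ _ ⟨a, b, ha, hb, rfl⟩ ⟨c, d, hc, hd, rfl⟩
    have hac : PrimeTo p (a * c) := IsCoprime.mul_left ha hc
    have hbd : PrimeTo p (b * d) := IsCoprime.mul_left hb hd
    refine ⟨a * c, b * d, hac, hbd, ?_⟩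
    have h1 : hac.unit = ha.unit * hc.unit := Units.ext (by simp [PrimeTo.unit])
    have h2 : hbd.unit = hb.unit * hd.unit := Units.ext (by simp [PrimeTo.unit])
    rw [h1, h2, div_mul_div_comm]
  inv_mem' := by
    rintro _ ⟨a, b, ha, hb, rfl⟩
    exact ⟨b, a, hb, ha, by rw [inv_div]⟩

/-- The group of all `g ∈ Kˣ` with `g ≡ 1 mod p`: those of the form `g = x / y` with
`x, y ∈ 𝓞 K`, `y` prime to `p` and `x ≡ y mod p`. -/
def congrOne : Subgroup Kˣ where
  carrier := {g | ∃ x y : 𝓞 K, IsUnit (j₁ p K y) ∧ j₁ p K x = j₁ p K y ∧ (g : K) * algebraMap (𝓞 K) K y = algebraMap (𝓞 K) K x}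
  one_mem' := ⟨1, 1, by simp, rfl, by simp⟩
  mul_mem' := by
    rintro g g' ⟨x, y, hy, hxy, h⟩ ⟨x', y', hy', hxy', h'⟩
    refine ⟨x * x', y * y', by rw [map_mul]; exact hy.mul hy', by simp only [map_mul, hxy, hxy'],
      ?_⟩
    rw [Units.val_mul, map_mul, map_mul, ← h, ← h']
    ring
  inv_mem' := by
    rintro g ⟨x, y, hy, hxy, h⟩
    exact ⟨y, x, hxy ▸ hy, hxy.symm, by rw [← h, Units.val_inv_eq_inv_val,
      inv_mul_cancel_left₀ g.ne_zero]⟩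

/-- The ray ideal group `H`: the principal fractional ideals of `K` that possess a generator
`g ≡ 1 mod p`. -/
def H : Subgroup (FractionalIdeal (𝓞 K)⁰ K)ˣ := (congrOne p K).map (toPrincipalIdeal (𝓞 K) K)

/-- The quotient group `I₀(K) / H`. -/
abbrev RayClassGroup : Type _ := I₀ p K ⧸ (H p K).subgroupOf (I₀ p K)

variable {p K}

/-- The class in `I₀(K) / H` of an integral ideal prime to `p`. -/
def PrimeTo.rayClass {I : Ideal (𝓞 K)} (hI : PrimeTo p I) : RayClassGroup p K :=
  QuotientGroup.mk ⟨hI.unit, I, 1, hI, primeTo_top p, by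
    rw [eq_div_iff_mul_eq']; exact Units.ext (by simp [PrimeTo.unit])⟩

end Ray

end CyclicPic

end

/-!
Let `R` and `S` be commutative rings with surjections `f` and `g` onto a local ring `k`. An
invertible module over `R ×ₖ S` is glued from invertible ideals `I` of `R` and `J` of `S`, prime to
`ker f` and `ker g`, along a unit `h` of `k`. Gluing is multiplicative in `(I, J, h)`, and the glued
module is free iff `I = (x)` and `J = (y)` with `f x = h * g y`. This determines `Pic (R ×ₖ S)`.

The ring `A` is such a fibre product over `F`, and `ℤC` is one of `ℤ` and `A` over `ℤ/p²`. Since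
`Pic ℤ = 1` and the cyclotomic units `1 + ζ + ⋯ + ζ ^ (r - 1)` of `A` lift all units of `ℤ/p²`, the
map `Pic ℤC → Pic A` is bijective.

Over `A` everything rests on the congruence `j₁ (N y) = j₂ y`. Write `y = P(ζ₂)` with `P` an
integral polynomial. As `ζ₂` is a `p`-th root of `ζ₁`, the norm of `y` is the determinant of `P(T)`,
where `T` is the companion matrix of `X ^ p - ζ₁`, and modulo `p` the Frobenius map makes this
determinant `P(ζ₁)`. Hence `M(N α, α, 1)` is free when `α` is principal, which yields the splitting,
and every unit of `ℤ[ζ₂]` has the same image in `F` as a unit of `ℤ[ζ₁]`. So `M(α, ℤ[ζ₂], h)` is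
free iff `α` has a generator `a` with `j₁ a = h`, that is, iff `h⁻¹ α` is trivial in `I₀ / H`.
-/

noncomputable section

namespace CyclicPic

section Groups

variable {T G G' : Type*} [Group G] [Group G']

section Surjective

variable [Monoid T] {u : T →* G} {v : T →* G'}

theorem exists_comp_eq_of_surjective (hu : Function.Surjective u) (h : ∀ t, u t = 1 → v t = 1) :
    ∃ φ : G →* G', φ.comp u = v := by
  have hker : Con.ker u ≤ Con.ker v := fun s t (hst : u s = u t) ↦ by
    obtain ⟨w, hw⟩ := hu (u t)⁻¹
    have hs : v (s * w) = 1 := h _ (by rw [map_mul, hst, hw, mul_inv_cancel])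
    have ht : v (t * w) = 1 := h _ (by rw [map_mul, hw, mul_inv_cancel])
    rw [map_mul] at hs ht
    exact mul_right_cancel (hs.trans ht.symm)
  refine ⟨((Con.ker u).lift v hker).comp (Con.quotientKerEquivOfSurjective u hu).symm,
    MonoidHom.ext fun t ↦ congrArg ((Con.ker u).lift v hker)
      ((Con.quotientKerEquivOfSurjective u hu).symm_apply_apply (t : (Con.ker u).Quotient))⟩

theorem exists_mulEquiv_of_surjective (hu : Function.Surjective u) (hv : Function.Surjective v)
    (h : ∀ t, u t = 1 ↔ v t = 1) : ∃ e : G ≃* G', ∀ t, e (u t) = v t := by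
  obtain ⟨φ, rfl⟩ := exists_comp_eq_of_surjective hu fun t ↦ (h t).1
  refine ⟨.ofBijective φ ⟨(injective_iff_map_eq_one φ).2 fun x hx ↦ ?_, .of_comp (g := u) hv⟩,
    fun _ ↦ rfl⟩
  obtain ⟨t, rfl⟩ := hu x
  exact (h t).2 hx

end Surjective

theorem isCompl_range_ker [Group T] {s : T →* G} {q : G →* G'}
    (h : Function.Bijective (q.comp s)) : IsCompl s.range q.ker := by
  refine ⟨disjoint_iff.2 <| eq_bot_iff.2 ?_, codisjoint_iff.2 <| eq_top_iff.2 fun x _ ↦ ?_⟩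
  · rintro _ ⟨⟨t, rfl⟩, ht : q (s t) = 1⟩
    rw [(injective_iff_map_eq_one _).1 h.1 t ht, map_one]
    exact one_mem _
  · obtain ⟨t, ht : q (s t) = q x⟩ := h.2 (q x)
    rw [← mul_inv_cancel_left (s t) x]
    refine Subgroup.mul_mem_sup ⟨t, rfl⟩ ?_
    rw [MonoidHom.mem_ker, map_mul, map_inv, ht, inv_mul_cancel]

theorem exists_sylow_mulEquiv {G G' : Type*} [CommGroup G] [CommGroup G'] {p : ℕ} (e : G ≃* G')
    (P : Sylow p G) (Q : Sylow p G') : ∃ e' : P ≃* Q, ∀ x : P, (e' x : G') = e x := by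
  have hle : P.map e.toMonoidHom ≤ Q := (P.isPGroup'.map _).le_sylow_of_normal Q
  have hge : Q.map e.symm.toMonoidHom ≤ P := (Q.isPGroup'.map _).le_sylow_of_normal P
  have heq : P.map e.toMonoidHom = Q :=
    hle.antisymm fun x hx ↦ ⟨e.symm x, hge ⟨x, hx, rfl⟩, e.apply_symm_apply x⟩
  exact ⟨(e.subgroupMap P).trans (.subgroupCongr heq), fun _ ↦ rfl⟩

end Groups

/-! ### Invertible modules -/

section InvertibleModule

open Module Module.Invertible

variable {R X : Type*} [CommRing R] [AddCommGroup X] [Module R X] [Module.Invertible R X]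

theorem dual_apply_smul_comm (f : Dual R X) (x y : X) : f x • y = f y • x := by
  simpa using congrArg (fun t ↦ TensorProduct.lid R X (f.rTensor X t))
    (tmul_comm (R := R) (m₁ := x) (m₂ := y))

variable (R X) in
theorem exists_sum_dual_apply_eq_one :
    ∃ s : Finset (Dual R X × X), ∑ i ∈ s, i.1 i.2 = 1 := by
  obtain ⟨s, hs⟩ := ((linearEquiv R X).symm 1).exists_finset
  exact ⟨s, by simpa [LinearEquiv.symm_apply_eq, linearEquiv, eq_comm] using hs⟩

theorem sum_dual_apply_smul {s : Finset (Dual R X × X)} (hs : ∑ i ∈ s, i.1 i.2 = 1) (x : X) :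
    ∑ i ∈ s, i.1 x • i.2 = x := by
  rw [Finset.sum_congr rfl fun i _ ↦ dual_apply_smul_comm i.1 x i.2, ← Finset.sum_smul, hs,
    one_smul]

theorem dual_injective_of_apply_mem_nonZeroDivisors {f : Dual R X} {x : X} (hx : f x ∈ R⁰) :
    Function.Injective f := by
  rw [injective_iff_map_eq_zero]
  intro y hy
  obtain ⟨s, hs⟩ := exists_sum_dual_apply_eq_one R X
  have (g : Dual R X) : g y = 0 := by
    rw [← mul_right_mem_nonZeroDivisors_eq_zero_iff hx, ← smul_eq_mul, ← map_smul,
      dual_apply_smul_comm, map_smul, hy, smul_zero]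
  rw [← sum_dual_apply_smul hs y]
  simp only [this, zero_smul, Finset.sum_const_zero]

theorem range_dual_mul_range_eval (f : Dual R X) (x : X) :
    (LinearMap.range f * LinearMap.range (Dual.eval R X x) : Ideal R) = Ideal.span {f x} := by
  have apply_mul_apply (g : Dual R X) (y : X) : f y * g x = g y * f x := by
    rw [mul_comm, ← smul_eq_mul, ← map_smul, dual_apply_smul_comm, map_smul, smul_eq_mul]
  refine le_antisymm (Ideal.mul_le.2 ?_) ((Ideal.span_singleton_le_iff_mem _).2 ?_)
  · rintro _ ⟨y, rfl⟩ _ ⟨g, rfl⟩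
    exact Ideal.mem_span_singleton'.2 ⟨g y, (apply_mul_apply g y).symm⟩
  · obtain ⟨s, hs⟩ := exists_sum_dual_apply_eq_one R X
    rw [← one_mul (f x), ← hs, Finset.sum_mul]
    refine sum_mem fun i _ ↦ ?_
    rw [← apply_mul_apply]
    exact Ideal.mul_mem_mul ⟨i.2, rfl⟩ ⟨i.1, rfl⟩

variable (R X) in
theorem picMk_eq_one_iff_exists_span_eq_top :
    Pic.mk R X = 1 ↔ ∃ x : X, Submodule.span R {x} = ⊤ := by
  rw [Pic.mk_eq_one_iff]
  constructor
  · rintro ⟨e⟩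
    refine ⟨e.symm 1, eq_top_iff.2 fun x _ ↦ Submodule.mem_span_singleton.2 ⟨e x, ?_⟩⟩
    rw [← map_smul, smul_eq_mul, mul_one, e.symm_apply_apply]
  · rintro ⟨x, hx⟩
    rw [← LinearMap.range_toSpanSingleton, LinearMap.range_eq_top] at hx
    exact ⟨(LinearEquiv.ofBijective _ (bijective_of_surjective hx)).symm⟩

theorem mapAlgebra_mk_eq {S N : Type*} [CommRing S] [Algebra R S] [AddCommGroup N]
    [Module R N] [Module S N] [IsScalarTower R S N] [Module.Invertible S N] (f : X →ₗ[R] N)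
    (hf : Function.Surjective f) : Pic.mapAlgebra R S (Pic.mk R X) = Pic.mk S N := by
  rw [Pic.mapAlgebra_apply, Pic.mk_eq_mk_iff]
  have hs : Function.Surjective (f.liftBaseChange S) := fun n ↦ by
    obtain ⟨x, rfl⟩ := hf n
    exact ⟨1 ⊗ₜ x, by simp⟩
  exact ⟨TensorProduct.AlgebraTensorModule.congr (.refl S S) (Pic.mk.linearEquiv R X) ≪≫ₗ
    .ofBijective _ (bijective_of_surjective hs)⟩

end InvertibleModule

section InvertibleSubmodules

variable (R T : Type*) [CommRing R] [CommRing T] [Algebra R T]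

/-- The extension of submodules of `T` to the total ring of fractions of `T`. -/
def mapFractionRing : Submodule R T →+* Submodule R (FractionRing T) :=
  Submodule.mapHom (IsScalarTower.toAlgHom R T (FractionRing T))

/-- The monoid of the `R`-submodules of an `R`-algebra `T` that are invertible as submodules of the
total ring of fractions of `T`. -/
def invertibleSubmodules : Submonoid (Submodule R T) :=
  (IsUnit.submonoid (Submodule R (FractionRing T))).comap (mapFractionRing R T)

variable {R T} in
theorem mem_invertibleSubmodules_of_mul_eq {N N' : Submodule R T} {t : T} (ht : t ∈ T⁰)
    (h : N * N' = Submodule.span R {t}) : N ∈ invertibleSubmodules R T := by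
  refine isUnit_of_mul_isUnit_left (y := mapFractionRing R T N') ?_
  rw [← map_mul, h]
  change IsUnit (Submodule.map _ _)
  rw [Submodule.map_span, Set.image_singleton]
  exact (IsLocalization.map_units (FractionRing T) (⟨t, ht⟩ : T⁰)).map (Submodule.spanSingleton R)

variable [FaithfulSMul R T]

instance : FaithfulSMul R (FractionRing T) := by
  rw [faithfulSMul_iff_algebraMap_injective, IsScalarTower.algebraMap_eq R T (FractionRing T)]
  exact (IsFractionRing.injective T (FractionRing T)).comp (FaithfulSMul.algebraMap_injective R T)

/-- The homomorphism that sends an invertible submodule to its class in the Picard group. -/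
def submoduleClass : invertibleSubmodules R T →* Pic R :=
  (Submodule.unitsToPic R (FractionRing T)).comp <| IsUnit.liftRight
    ((mapFractionRing R T).toMonoidHom.comp (invertibleSubmodules R T).subtype) fun N ↦ N.2

variable {R T}

theorem nonempty_linearEquiv_submoduleClass (N : invertibleSubmodules R T) :
    Nonempty (submoduleClass R T N ≃ₗ[R] N.1) :=
  ⟨(Submodule.unitsToPicEquiv _).trans (Submodule.equivMapOfInjective
    (IsScalarTower.toAlgHom R T (FractionRing T)).toLinearMap
    (IsFractionRing.injective T (FractionRing T)) N.1).symm⟩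

theorem invertible_of_mem {N : Submodule R T} (hN : N ∈ invertibleSubmodules R T) :
    Module.Invertible R N :=
  .congr (nonempty_linearEquiv_submoduleClass ⟨N, hN⟩).some

theorem submoduleClass_eq_iff {N : invertibleSubmodules R T} {X : Pic R} :
    submoduleClass R T N = X ↔ Nonempty (X ≃ₗ[R] N.1) := by
  obtain ⟨e⟩ := nonempty_linearEquiv_submoduleClass N
  rw [eq_comm, Pic.ext_iff]
  exact ⟨fun ⟨e'⟩ ↦ ⟨e'.trans e⟩, fun ⟨e'⟩ ↦ ⟨e'.trans e.symm⟩⟩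

theorem submoduleClass_eq_mk (N : invertibleSubmodules R T) [Module.Invertible R N.1] :
    submoduleClass R T N = Pic.mk R N.1 :=
  submoduleClass_eq_iff.2 ⟨Pic.mk.linearEquiv R N.1⟩

theorem submoduleClass_eq_one_iff {N : invertibleSubmodules R T} :
    submoduleClass R T N = 1 ↔ ∃ t, N.1 = Submodule.span R {t} := by
  have := invertible_of_mem N.2
  rw [submoduleClass_eq_mk, picMk_eq_one_iff_exists_span_eq_top]
  constructor
  · rintro ⟨t, ht⟩
    exact ⟨t, by simpa using congrArg (Submodule.map N.1.subtype) ht.symm⟩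
  · rintro ⟨t, ht⟩
    have htN : t ∈ N.1 := ht ▸ Submodule.mem_span_singleton_self t
    refine ⟨⟨t, htN⟩, Submodule.map_injective_of_injective N.1.injective_subtype ?_⟩
    simp [Submodule.map_span, ← ht]

end InvertibleSubmodules

/-! ### Ideals that are invertible away from the kernel of a ring homomorphism -/

section InvertibleIdeals

variable {R k : Type*} [CommRing R] [CommRing k] (f : R →+* k)

/-- The ideals that are invertible and prime to the kernel of `f`: those with an inverse up to a
regular element that becomes a unit under `f`. -/
def invertibleIdeals : Submonoid (Ideal R) where
  carrier := {I | ∃ (I' : Ideal R) (s : R), I * I' = Ideal.span {s} ∧ s ∈ R⁰ ∧ IsUnit (f s)}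
  one_mem' := ⟨1, 1, by simp, one_mem _, by simp⟩
  mul_mem' := by
    rintro I J ⟨I', s, hI, hs, hfs⟩ ⟨J', t, hJ, ht, hft⟩
    refine ⟨I' * J', s * t, ?_, mul_mem hs ht, by rw [map_mul]; exact hfs.mul hft⟩
    rw [mul_mul_mul_comm, hI, hJ, Ideal.span_singleton_mul_span_singleton]

variable {f} {I : Ideal R}

theorem mem_nonZeroDivisors_of_isUnit_map [IsDomain R] [Nontrivial k] {s : R} (hs : IsUnit (f s)) :
    s ∈ R⁰ :=
  mem_nonZeroDivisors_of_ne_zero fun h ↦ hs.ne_zero (h ▸ map_zero f)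

theorem span_singleton_mem_invertibleIdeals {s : R} (hs : s ∈ R⁰) (hfs : IsUnit (f s)) :
    Ideal.span {s} ∈ invertibleIdeals f :=
  ⟨⊤, s, Ideal.mul_top _, hs, hfs⟩

theorem exists_isUnit_map_of_mem (hI : I ∈ invertibleIdeals f) : ∃ a ∈ I, IsUnit (f a) := by
  obtain ⟨I', s, h, -, hs⟩ := hI
  exact ⟨s, Ideal.mul_le_left (h ▸ Ideal.mem_span_singleton_self s), hs⟩

variable (f) in
/-- The elements of `R` that become units under `f`. -/
abbrev unitsComap : Submonoid R := (IsUnit.submonoid k).comap f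

variable (f) in
/-- The homomorphism that reduces the elements of `R` that become units under `f`. -/
def mapUnitsComap : unitsComap f →* kˣ :=
  IsUnit.liftRight ((f : R →* k).comp (unitsComap f).subtype) fun x ↦ x.2

variable (f) in
/-- The homomorphism that sends an element that becomes a unit under `f` to the ideal it
generates. -/
def principalIdeal [IsDomain R] [Nontrivial k] : unitsComap f →* invertibleIdeals f where
  toFun x := ⟨Ideal.span {x.1},
    span_singleton_mem_invertibleIdeals (mem_nonZeroDivisors_of_isUnit_map x.2) x.2⟩
  map_one' := Subtype.ext (Ideal.span_singleton_one.trans Ideal.one_eq_top.symm)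
  map_mul' x y := Subtype.ext (Ideal.span_singleton_mul_span_singleton x.1 y.1).symm

theorem isUnit_map_of_span_mem {x : R} (hx : Ideal.span {x} ∈ invertibleIdeals f) :
    IsUnit (f x) := by
  obtain ⟨a, ha, hu⟩ := exists_isUnit_map_of_mem hx
  obtain ⟨b, rfl⟩ := Ideal.mem_span_singleton'.1 ha
  rw [map_mul] at hu
  exact isUnit_of_mul_isUnit_right hu

theorem exists_map_eq_of_mem (hf : Function.Surjective f) (hI : I ∈ invertibleIdeals f) (c : k) :
    ∃ a ∈ I, f a = c := by
  obtain ⟨a, ha, hu⟩ := exists_isUnit_map_of_mem hI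
  obtain ⟨b, hb⟩ := hf (c * hu.unit⁻¹)
  exact ⟨b * a, I.mul_mem_left _ ha, by rw [map_mul, hb, mul_assoc, IsUnit.val_inv_mul, mul_one]⟩

theorem invertibleIdeals_le_invertibleSubmodules (f : R →+* k) :
    invertibleIdeals f ≤ invertibleSubmodules R R := by
  rintro I ⟨I', s, h, hs, -⟩
  exact mem_invertibleSubmodules_of_mul_eq hs h

variable (f) in
/-- The homomorphism that sends an invertible ideal prime to the kernel of `f` to its class in the
Picard group. -/
def idealClass : invertibleIdeals f →* Pic R :=
  (submoduleClass R R).comp (Submonoid.inclusion (invertibleIdeals_le_invertibleSubmodules f))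

theorem idealClass_eq_iff {I : invertibleIdeals f} {X : Pic R} :
    idealClass f I = X ↔ Nonempty (X ≃ₗ[R] I.1) :=
  submoduleClass_eq_iff

theorem idealClass_eq_mk (I : invertibleIdeals f) [Module.Invertible R I.1] :
    idealClass f I = Pic.mk R I.1 :=
  idealClass_eq_iff.2 ⟨Pic.mk.linearEquiv R I.1⟩

theorem idealClass_eq_one_iff {I : invertibleIdeals f} :
    idealClass f I = 1 ↔ ∃ x, I.1 = Ideal.span {x} :=
  submoduleClass_eq_one_iff

theorem mem_invertibleIdeals_iff [IsDedekindDomain R] [Nontrivial k] :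
    I ∈ invertibleIdeals f ↔ ∃ a ∈ I, IsUnit (f a) := by
  refine ⟨exists_isUnit_map_of_mem, fun ⟨a, ha, hu⟩ ↦ ?_⟩
  obtain ⟨I', hI'⟩ := Ideal.dvd_span_singleton.2 ha
  exact ⟨I', a, hI'.symm, mem_nonZeroDivisors_of_isUnit_map hu, hu⟩

theorem equivPic_mk0_eq_idealClass [IsDedekindDomain R] {I : (Ideal R)⁰}
    (hI : I.1 ∈ invertibleIdeals f) :
    ClassGroup.equivPic R (ClassGroup.mk0 I) = idealClass f ⟨I, hI⟩ := by
  have := invertible_of_mem (invertibleIdeals_le_invertibleSubmodules f hI)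
  rw [idealClass_eq_mk, ClassGroup.mk0_eq_quotientMk, eq_comm, Pic.mk_eq_iff]
  let U := FractionalIdeal.unitsMulEquivSubmodule (FractionalIdeal.mk0 (FractionRing R) I)
  have e : Submodule.unitsToPic R (FractionRing R) U ≃ₗ[R] U := Submodule.unitsToPicEquiv U
  exact ⟨(Submodule.equivMapOfInjective (Algebra.linearMap R (FractionRing R))
    (IsFractionRing.injective R (FractionRing R)) I.1).trans e.symm⟩

theorem exists_linearEquiv_mem_invertibleIdeals [IsLocalRing k]
    (hf : ∀ s, IsUnit (f s) → s ∈ R⁰) (X : Type*) [AddCommGroup X] [Module R X]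
    [Module.Invertible R X] : ∃ I ∈ invertibleIdeals f, Nonempty (X ≃ₗ[R] I) := by
  obtain ⟨s, hs⟩ := exists_sum_dual_apply_eq_one R X
  have hu : IsUnit (∑ i ∈ s, f (i.1 i.2)) := by rw [← map_sum, hs, map_one]; exact isUnit_one
  obtain ⟨⟨g, x⟩, -, hgx⟩ := IsLocalRing.exists_of_isUnit_sum hu
  exact ⟨LinearMap.range g, ⟨_, g x, range_dual_mul_range_eval g x, hf _ hgx, hgx⟩,
    ⟨.ofInjective g (dual_injective_of_apply_mem_nonZeroDivisors (hf _ hgx))⟩⟩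

theorem idealClass_surjective [IsLocalRing k] (hf : ∀ s, IsUnit (f s) → s ∈ R⁰) :
    Function.Surjective (idealClass f) := fun X ↦ by
  obtain ⟨I, hI, e⟩ := exists_linearEquiv_mem_invertibleIdeals hf X
  exact ⟨⟨I, hI⟩, idealClass_eq_iff.2 e⟩

end InvertibleIdeals

/-! ### Gluing ideals over a fibre product -/

section Glue

variable {R S k : Type*} [CommRing R] [CommRing S] [CommRing k]

/-- The fibre product `R ×ₖ S` of two rings, as a subring of `R × S`; `A` is the fibre product of
`j₁` and `j₂`. -/
def fiberProduct (f : R →+* k) (g : S →+* k) : Subring (R × S) :=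
  RingHom.eqLocus (f.comp (RingHom.fst R S)) (g.comp (RingHom.snd R S))

variable (f : R →+* k) (g : S →+* k)

instance : FaithfulSMul (fiberProduct f g) (R × S) :=
  (faithfulSMul_iff_algebraMap_injective _ _).2 Subtype.val_injective

/-- The first projection of a fibre product. -/
def fiberFst : fiberProduct f g →+* R := (RingHom.fst R S).comp (fiberProduct f g).subtype

/-- The second projection of a fibre product. -/
def fiberSnd : fiberProduct f g →+* S := (RingHom.snd R S).comp (fiberProduct f g).subtype

/-- The pairs in `I × J` that agree over `k` up to the unit `h`; `M` is the case of `j₁` and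
`j₂`. -/
def glue (I : Ideal R) (J : Ideal S) (h : kˣ) : Submodule (fiberProduct f g) (R × S) where
  carrier := {t | t.1 ∈ I ∧ t.2 ∈ J ∧ f t.1 = h * g t.2}
  zero_mem' := by simp
  add_mem' := by
    rintro x y ⟨hx₁, hx₂, hx⟩ ⟨hy₁, hy₂, hy⟩
    exact ⟨add_mem hx₁ hy₁, add_mem hx₂ hy₂, by simp only [Prod.fst_add, Prod.snd_add, map_add, hx,
      hy, mul_add]⟩
  smul_mem' := by
    rintro ⟨c, hc : f c.1 = g c.2⟩ x ⟨hx₁, hx₂, hx⟩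
    refine ⟨I.mul_mem_left c.1 hx₁, J.mul_mem_left c.2 hx₂, ?_⟩
    change f (c.1 * x.1) = h * g (c.2 * x.2)
    rw [map_mul, map_mul, hx, hc, mul_left_comm]

variable {f g} {I I' : Ideal R} {J J' : Ideal S} {h h' : kˣ}

theorem mem_fiberProduct {t : R × S} : t ∈ fiberProduct f g ↔ f t.1 = g t.2 := Iff.rfl

theorem fiberSnd_surjective (hf : Function.Surjective f) : Function.Surjective (fiberSnd f g) :=
  fun y ↦ by
    obtain ⟨x, hx⟩ := hf (g y)
    exact ⟨⟨(x, y), hx⟩, rfl⟩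

theorem fiberFst_surjective (hg : Function.Surjective g) : Function.Surjective (fiberFst f g) :=
  fun x ↦ by
    obtain ⟨y, hy⟩ := hg (f x)
    exact ⟨⟨(x, y), hy.symm⟩, rfl⟩

theorem prodMk_mem_nonZeroDivisors {x : R} {y : S} (hx : x ∈ R⁰) (hy : y ∈ S⁰) :
    (x, y) ∈ (R × S)⁰ := by
  rw [mem_nonZeroDivisors_iff_right]
  intro z hz
  exact Prod.ext ((mul_right_mem_nonZeroDivisors_eq_zero_iff hx).1 (congrArg Prod.fst hz))
    ((mul_right_mem_nonZeroDivisors_eq_zero_iff hy).1 (congrArg Prod.snd hz))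

theorem mem_nonZeroDivisors_fiberProduct {a : fiberProduct f g} (h₁ : a.1.1 ∈ R⁰)
    (h₂ : a.1.2 ∈ S⁰) : a ∈ (fiberProduct f g)⁰ :=
  mem_nonZeroDivisors_of_injective (f := (fiberProduct f g).subtype) Subtype.val_injective
    (prodMk_mem_nonZeroDivisors h₁ h₂)

theorem exists_mem_glue_fst (hg : Function.Surjective g) (hJ : J ∈ invertibleIdeals g) {x : R}
    (hx : x ∈ I) : ∃ t ∈ glue f g I J h, t.1 = x := by
  obtain ⟨y, hy, hxy⟩ := exists_map_eq_of_mem hg hJ (↑h⁻¹ * f x)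
  exact ⟨(x, y), ⟨hx, hy, by rw [hxy, Units.mul_inv_cancel_left]⟩, rfl⟩

theorem exists_mem_glue_snd (hf : Function.Surjective f) (hI : I ∈ invertibleIdeals f) {y : S}
    (hy : y ∈ J) : ∃ t ∈ glue f g I J h, t.2 = y := by
  obtain ⟨x, hx, hxy⟩ := exists_map_eq_of_mem hf hI (h * g y)
  exact ⟨(x, y), ⟨hx, hy, hxy⟩, rfl⟩

/-- Modulo `N`, an element of the glued module has the form `(0, c)` with `g c = 0`. If `e ∈ N` has
second component `1` in `k`, and `v ∈ N` has second component `c`, then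
`(0, c) = (0, c) * e + (0, 1 - e.2) * v` lies in `N`. -/
theorem eq_glue (hg : Function.Surjective g) (hJ : J ∈ invertibleIdeals g)
    {N : Submodule (fiberProduct f g) (R × S)} (hN : N ≤ glue f g I J h)
    (hfst : ∀ x ∈ I, ∃ t ∈ N, t.1 = x) (hsnd : ∀ y ∈ J, ∃ t ∈ N, t.2 = y) :
    N = glue f g I J h := by
  refine le_antisymm hN fun t ht ↦ ?_
  obtain ⟨u, hu, hut⟩ := hfst t.1 ht.1
  obtain ⟨hc, hgc⟩ : t.2 - u.2 ∈ J ∧ g (t.2 - u.2) = 0 := by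
    obtain ⟨-, hc, hgc⟩ := sub_mem ht (hN hu)
    refine ⟨hc, ?_⟩
    rwa [Prod.fst_sub, hut, sub_self, map_zero, eq_comm, Units.mul_right_eq_zero] at hgc
  obtain ⟨e₂, he₂, hge⟩ := exists_map_eq_of_mem hg hJ 1
  obtain ⟨e, he, rfl⟩ := hsnd e₂ he₂
  obtain ⟨v, hv, hvc⟩ := hsnd _ hc
  let r : fiberProduct f g := ⟨(0, t.2 - u.2), by simp [mem_fiberProduct, hgc]⟩
  let s : fiberProduct f g := ⟨(0, 1 - e.2), by simp [mem_fiberProduct, hge]⟩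
  have : t = u + (r • e + s • v) := by
    refine Prod.ext ?_ ?_
    · change t.1 = u.1 + (0 * e.1 + 0 * v.1)
      rw [hut, zero_mul, zero_mul, add_zero, add_zero]
    · change t.2 = u.2 + ((t.2 - u.2) * e.2 + (1 - e.2) * v.2)
      rw [hvc]
      ring
  rw [this]
  exact add_mem hu (add_mem (N.smul_mem r he) (N.smul_mem s hv))

theorem glue_one : glue f g 1 1 1 = 1 := by
  ext t
  rw [Ideal.one_eq_top, Ideal.one_eq_top, Submodule.mem_one]
  constructor
  · rintro ⟨-, -, ht⟩
    exact ⟨⟨t, mem_fiberProduct.2 (by rwa [Units.val_one, one_mul] at ht)⟩, rfl⟩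
  · rintro ⟨⟨r, hr⟩, rfl⟩
    exact ⟨trivial, trivial, by rw [Units.val_one, one_mul]; exact hr⟩

theorem glue_mul_glue_le :
    glue f g I J h * glue f g I' J' h' ≤ glue f g (I * I') (J * J') (h * h') := by
  rw [Submodule.mul_le]
  rintro t ⟨ht₁, ht₂, ht⟩ u ⟨hu₁, hu₂, hu⟩
  refine ⟨Ideal.mul_mem_mul ht₁ hu₁, Ideal.mul_mem_mul ht₂ hu₂, ?_⟩
  rw [Prod.fst_mul, Prod.snd_mul, map_mul, map_mul, ht, hu, Units.val_mul, mul_mul_mul_comm]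

theorem glue_mul_glue (hf : Function.Surjective f) (hg : Function.Surjective g)
    (hI : I ∈ invertibleIdeals f) (hJ : J ∈ invertibleIdeals g) (hI' : I' ∈ invertibleIdeals f)
    (hJ' : J' ∈ invertibleIdeals g) :
    glue f g I J h * glue f g I' J' h' = glue f g (I * I') (J * J') (h * h') := by
  refine eq_glue hg (mul_mem hJ hJ') glue_mul_glue_le (fun x hx ↦ ?_) fun y hy ↦ ?_
  · induction hx using Submodule.mul_induction_on' with
    | mem_mul_mem a ha b hb =>
      obtain ⟨t, ht, rfl⟩ := exists_mem_glue_fst hg hJ ha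
      obtain ⟨u, hu, rfl⟩ := exists_mem_glue_fst hg hJ' hb
      exact ⟨t * u, Submodule.mul_mem_mul ht hu, rfl⟩
    | add x _ y _ hx hy =>
      obtain ⟨t, ht, rfl⟩ := hx
      obtain ⟨u, hu, rfl⟩ := hy
      exact ⟨t + u, add_mem ht hu, rfl⟩
  · induction hy using Submodule.mul_induction_on' with
    | mem_mul_mem a ha b hb =>
      obtain ⟨t, ht, rfl⟩ := exists_mem_glue_snd hf hI ha
      obtain ⟨u, hu, rfl⟩ := exists_mem_glue_snd hf hI' hb
      exact ⟨t * u, Submodule.mul_mem_mul ht hu, rfl⟩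
    | add x _ y _ hx hy =>
      obtain ⟨t, ht, rfl⟩ := hx
      obtain ⟨u, hu, rfl⟩ := hy
      exact ⟨t + u, add_mem ht hu, rfl⟩

theorem eq_span_of_glue_eq_span_fst (hg : Function.Surjective g) (hJ : J ∈ invertibleIdeals g)
    {t : R × S} (ht : glue f g I J h = Submodule.span (fiberProduct f g) {t}) :
    I = Ideal.span {t.1} := by
  have htm : t ∈ glue f g I J h := ht ▸ Submodule.mem_span_singleton_self t
  refine le_antisymm (fun x hx ↦ ?_) ((Ideal.span_singleton_le_iff_mem _).2 htm.1)
  obtain ⟨u, hu, rfl⟩ := exists_mem_glue_fst (h := h) hg hJ hx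
  obtain ⟨r, rfl⟩ := Submodule.mem_span_singleton.1 (ht ▸ hu)
  exact Ideal.mem_span_singleton'.2 ⟨r.1.1, rfl⟩

theorem eq_span_of_glue_eq_span_snd (hf : Function.Surjective f) (hI : I ∈ invertibleIdeals f)
    {t : R × S} (ht : glue f g I J h = Submodule.span (fiberProduct f g) {t}) :
    J = Ideal.span {t.2} := by
  have htm : t ∈ glue f g I J h := ht ▸ Submodule.mem_span_singleton_self t
  refine le_antisymm (fun x hx ↦ ?_) ((Ideal.span_singleton_le_iff_mem _).2 htm.2.1)
  obtain ⟨u, hu, rfl⟩ := exists_mem_glue_snd (h := h) hf hI hx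
  obtain ⟨r, rfl⟩ := Submodule.mem_span_singleton.1 (ht ▸ hu)
  exact Ideal.mem_span_singleton'.2 ⟨r.1.2, rfl⟩

theorem glue_span_singleton (hf : Function.Surjective f) (hg : Function.Surjective g) {x : R}
    {y : S} (hy : Ideal.span {y} ∈ invertibleIdeals g) (hxy : f x = h * g y) :
    glue f g (Ideal.span {x}) (Ideal.span {y}) h = Submodule.span (fiberProduct f g) {(x, y)} := by
  refine (eq_glue hg hy ?_ (fun a ha ↦ ?_) fun b hb ↦ ?_).symm
  · rw [Submodule.span_singleton_le_iff_mem]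
    exact ⟨Ideal.mem_span_singleton_self x, Ideal.mem_span_singleton_self y, hxy⟩
  · obtain ⟨a, rfl⟩ := Ideal.mem_span_singleton'.1 ha
    obtain ⟨r, rfl⟩ := fiberFst_surjective (f := f) hg a
    exact ⟨r • (x, y), Submodule.mem_span_singleton.2 ⟨r, rfl⟩, rfl⟩
  · obtain ⟨b, rfl⟩ := Ideal.mem_span_singleton'.1 hb
    obtain ⟨r, rfl⟩ := fiberSnd_surjective (g := g) hf b
    exact ⟨r • (x, y), Submodule.mem_span_singleton.2 ⟨r, rfl⟩, rfl⟩

theorem glue_mem_invertibleSubmodules (hf : Function.Surjective f) (hg : Function.Surjective g)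
    (hI : I ∈ invertibleIdeals f) (hJ : J ∈ invertibleIdeals g) (h : kˣ) :
    glue f g I J h ∈ invertibleSubmodules (fiberProduct f g) (R × S) := by
  obtain ⟨I', x, hxI, hx, hfx⟩ := id hI
  obtain ⟨J', y, hyJ, hy, hgy⟩ := id hJ
  have hI' : I' ∈ invertibleIdeals f := ⟨I, x, by rw [mul_comm, hxI], hx, hfx⟩
  have hJ' : J' ∈ invertibleIdeals g := ⟨J, y, by rw [mul_comm, hyJ], hy, hgy⟩
  refine mem_invertibleSubmodules_of_mul_eq (prodMk_mem_nonZeroDivisors hx hy)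
    (N' := glue f g I' J' (h⁻¹ * (hfx.unit * hgy.unit⁻¹))) ?_
  rw [glue_mul_glue hf hg hI hJ hI' hJ', hxI, hyJ,
    glue_span_singleton hf hg (span_singleton_mem_invertibleIdeals hy hgy) (by simp [mul_assoc])]

theorem mapRingHom_fiberSnd_mk_glue [Module.Invertible (fiberProduct f g) (glue f g I J h)]
    [Module.Invertible S J] (hf : Function.Surjective f)
    (hI : I ∈ invertibleIdeals f) :
    Pic.mapRingHom (fiberSnd f g) (Pic.mk (fiberProduct f g) (glue f g I J h)) = Pic.mk S J := by
  let := (fiberSnd f g).toAlgebra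
  let φ : glue f g I J h →ₗ[fiberProduct f g] J :=
    { toFun := fun t ↦ ⟨t.1.2, t.2.2.1⟩
      map_add' := fun _ _ ↦ rfl
      map_smul' := fun _ _ ↦ rfl }
  refine mapAlgebra_mk_eq φ fun y ↦ ?_
  obtain ⟨t, ht, hty⟩ := exists_mem_glue_snd (h := h) hf hI y.2
  exact ⟨⟨t, ht⟩, Subtype.ext hty⟩

variable (hf : Function.Surjective f) (hg : Function.Surjective g)

include hf hg in
theorem invertible_glue {I : Ideal R} {J : Ideal S} (hI : I ∈ invertibleIdeals f)
    (hJ : J ∈ invertibleIdeals g) (h : kˣ) :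
    Module.Invertible (fiberProduct f g) (glue f g I J h) :=
  invertible_of_mem (glue_mem_invertibleSubmodules hf hg hI hJ h)

/-- The homomorphism that sends `(I, J, h)` to the class of the glued module in the Picard group of
the fibre product. -/
def glueClass : invertibleIdeals f × invertibleIdeals g × kˣ →* Pic (fiberProduct f g) :=
  (submoduleClass (fiberProduct f g) (R × S)).comp
    { toFun := fun a ↦ ⟨glue f g a.1 a.2.1 a.2.2,
        glue_mem_invertibleSubmodules hf hg a.1.2 a.2.1.2 a.2.2⟩
      map_one' := Subtype.ext glue_one
      map_mul' := fun a b ↦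
        Subtype.ext (glue_mul_glue hf hg a.1.2 a.2.1.2 b.1.2 b.2.1.2).symm }

theorem glueClass_eq_iff {a : invertibleIdeals f × invertibleIdeals g × kˣ}
    {X : Pic (fiberProduct f g)} :
    glueClass hf hg a = X ↔ Nonempty (X ≃ₗ[fiberProduct f g] glue f g a.1 a.2.1 a.2.2) :=
  submoduleClass_eq_iff

theorem glueClass_eq_one_iff {a : invertibleIdeals f × invertibleIdeals g × kˣ} :
    glueClass hf hg a = 1 ↔ ∃ x y, a.1.1 = Ideal.span {x} ∧ a.2.1.1 = Ideal.span {y} ∧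
      f x = a.2.2 * g y := by
  obtain ⟨⟨I, hI⟩, ⟨J, hJ⟩, h⟩ := a
  refine submoduleClass_eq_one_iff.trans ⟨?_, ?_⟩
  · rintro ⟨t, ht : glue f g I J h = _⟩
    have htm : t ∈ glue f g I J h := ht ▸ Submodule.mem_span_singleton_self t
    exact ⟨t.1, t.2, eq_span_of_glue_eq_span_fst hg hJ ht, eq_span_of_glue_eq_span_snd hf hI ht,
      htm.2.2⟩
  · rintro ⟨x, y, rfl : I = _, rfl : J = _, hxy⟩
    exact ⟨(x, y), glue_span_singleton hf hg hJ hxy⟩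

theorem mapRingHom_fiberSnd_glueClass (a : invertibleIdeals f × invertibleIdeals g × kˣ) :
    Pic.mapRingHom (fiberSnd f g) (glueClass hf hg a) = idealClass g a.2.1 := by
  have := invertible_glue hf hg a.1.2 a.2.1.2 a.2.2
  have := invertible_of_mem (invertibleIdeals_le_invertibleSubmodules g a.2.1.2)
  have : glueClass hf hg a = Pic.mk _ (glue f g a.1 a.2.1 a.2.2) :=
    (glueClass_eq_iff hf hg).2 ⟨Pic.mk.linearEquiv _ _⟩
  rw [this, idealClass_eq_mk, mapRingHom_fiberSnd_mk_glue hf a.1.2]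

theorem glueClass_one_eq_one_iff {I : invertibleIdeals f} {h : kˣ} :
    glueClass hf hg (I, 1, h) = 1 ↔ ∃ (x : R) (u : Sˣ), I.1 = Ideal.span {x} ∧ f x = h * g u := by
  rw [glueClass_eq_one_iff]
  constructor
  · rintro ⟨x, y, hx, hy, hxy⟩
    have hu : IsUnit y := Ideal.span_singleton_eq_top.1 (hy.symm.trans Ideal.one_eq_top)
    exact ⟨x, hu.unit, hx, hxy⟩
  · rintro ⟨x, u, hx, hxu⟩
    exact ⟨x, u, hx, Ideal.one_eq_top.trans (Ideal.span_singleton_eq_top.2 u.isUnit).symm, hxu⟩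

theorem exists_glueClass_eq_of_ideal (hfr : ∀ s, IsUnit (f s) → s ∈ R⁰)
    (hgr : ∀ s, IsUnit (g s) → s ∈ S⁰) {N : Ideal (fiberProduct f g)}
    (hN : N ∈ invertibleIdeals (f.comp (fiberFst f g))) {X : Pic (fiberProduct f g)}
    (e : X ≃ₗ[fiberProduct f g] N) : ∃ I J, glueClass hf hg (I, J, 1) = X := by
  obtain ⟨N', s, hNs, -, hs : IsUnit (f s.1.1)⟩ := hN
  have hs' : IsUnit (g s.1.2) := (mem_fiberProduct.1 s.2) ▸ hs
  have hI : N.map (fiberFst f g) ∈ invertibleIdeals f :=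
    ⟨N'.map _, s.1.1, by rw [← Ideal.map_mul, hNs, Ideal.map_span, Set.image_singleton]; rfl,
      hfr _ hs, hs⟩
  have hJ : N.map (fiberSnd f g) ∈ invertibleIdeals g :=
    ⟨N'.map _, s.1.2, by rw [← Ideal.map_mul, hNs, Ideal.map_span, Set.image_singleton]; rfl,
      hgr _ hs', hs'⟩
  let ι : fiberProduct f g →ₗ[fiberProduct f g] R × S := Algebra.linearMap _ _
  have hι : Submodule.map ι N = glue f g (N.map (fiberFst f g)) (N.map (fiberSnd f g)) 1 := by
    refine eq_glue hg hJ ?_ (fun x hx ↦ ?_) fun y hy ↦ ?_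
    · rintro _ ⟨r, hr, rfl⟩
      exact ⟨Ideal.mem_map_of_mem (fiberFst f g) hr, Ideal.mem_map_of_mem (fiberSnd f g) hr,
        by rw [Units.val_one, one_mul]; exact r.2⟩
    · obtain ⟨r, hr, rfl⟩ := (Ideal.mem_map_iff_of_surjective _ (fiberFst_surjective hg)).1 hx
      exact ⟨r, ⟨r, hr, rfl⟩, rfl⟩
    · obtain ⟨r, hr, rfl⟩ := (Ideal.mem_map_iff_of_surjective _ (fiberSnd_surjective hf)).1 hy
      exact ⟨r, ⟨r, hr, rfl⟩, rfl⟩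
  exact ⟨⟨_, hI⟩, ⟨_, hJ⟩, (glueClass_eq_iff hf hg).2 ⟨(e.trans
    (Submodule.equivMapOfInjective ι Subtype.val_injective N)).trans (.ofEq _ _ hι)⟩⟩

theorem exists_glueClass_eq [IsLocalRing k] (hfr : ∀ s, IsUnit (f s) → s ∈ R⁰)
    (hgr : ∀ s, IsUnit (g s) → s ∈ S⁰) (X : Pic (fiberProduct f g)) :
    ∃ I J, glueClass hf hg (I, J, 1) = X := by
  have hr (s : fiberProduct f g) (hs : IsUnit (f s.1.1)) : s ∈ (fiberProduct f g)⁰ :=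
    mem_nonZeroDivisors_fiberProduct (hfr _ hs) (hgr _ ((mem_fiberProduct.1 s.2) ▸ hs))
  obtain ⟨N, hN, ⟨e⟩⟩ :=
    exists_linearEquiv_mem_invertibleIdeals (f := f.comp (fiberFst f g)) hr X
  exact exists_glueClass_eq_of_ideal hf hg hfr hgr hN e

theorem mem_ker_mapRingHom_fiberSnd_iff [IsLocalRing k] (hfr : ∀ s, IsUnit (f s) → s ∈ R⁰)
    (hgr : ∀ s, IsUnit (g s) → s ∈ S⁰) {X : Pic (fiberProduct f g)} :
    X ∈ (Pic.mapRingHom (fiberSnd f g)).ker ↔ ∃ I h, glueClass hf hg (I, 1, h) = X := by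
  rw [MonoidHom.mem_ker]
  constructor
  · obtain ⟨I, J, rfl⟩ := exists_glueClass_eq hf hg hfr hgr X
    rw [mapRingHom_fiberSnd_glueClass, idealClass_eq_one_iff]
    rintro ⟨y, hy⟩
    have hu : IsUnit (g y) := isUnit_map_of_span_mem (hy ▸ J.2)
    have hJ : glueClass hf hg (1, J, hu.unit⁻¹) = 1 :=
      (glueClass_eq_one_iff hf hg).2 ⟨1, y, by simp, hy, by simp⟩
    refine ⟨I, hu.unit, ?_⟩
    rw [← mul_one (glueClass hf hg _), ← hJ, ← map_mul]
    simp
  · rintro ⟨I, h, rfl⟩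
    rw [mapRingHom_fiberSnd_glueClass, map_one]

include hf hg in
theorem mapRingHom_fiberSnd_surjective [IsLocalRing k] (hgr : ∀ s, IsUnit (g s) → s ∈ S⁰) :
    Function.Surjective (Pic.mapRingHom (fiberSnd f g)) := fun X ↦ by
  obtain ⟨J, rfl⟩ := idealClass_surjective hgr X
  exact ⟨glueClass hf hg (1, J, 1), mapRingHom_fiberSnd_glueClass hf hg _⟩

include hf hg in
theorem mapRingHom_fiberSnd_bijective [IsLocalRing k] [Subsingleton (Pic R)]
    (hfr : ∀ s, IsUnit (f s) → s ∈ R⁰) (hgr : ∀ s, IsUnit (g s) → s ∈ S⁰)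
    (hu : ∀ h : kˣ, ∃ u : Sˣ, g u = h) :
    Function.Bijective (Pic.mapRingHom (fiberSnd f g)) := by
  refine ⟨(injective_iff_map_eq_one _).2 fun X hX ↦ ?_,
    mapRingHom_fiberSnd_surjective hf hg hgr⟩
  obtain ⟨I, h, rfl⟩ := (mem_ker_mapRingHom_fiberSnd_iff hf hg hfr hgr).1 hX
  obtain ⟨x, hx⟩ := idealClass_eq_one_iff.1 (Subsingleton.elim (idealClass f I) 1)
  obtain ⟨u, hu⟩ := hu (h⁻¹ * (isUnit_map_of_span_mem (hx ▸ I.2)).unit)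
  exact (glueClass_one_eq_one_iff hf hg).2 ⟨x, u, hx, by simp [hu]⟩

theorem glueClass_one_eq_one_iff_exists_generator (hu : ∀ u : Sˣ, ∃ v : Rˣ, f v = g u)
    {I : invertibleIdeals f} {h : kˣ} :
    glueClass hf hg (I, 1, h) = 1 ↔ ∃ x, I.1 = Ideal.span {x} ∧ f x = h := by
  rw [glueClass_one_eq_one_iff]
  constructor
  · rintro ⟨x, u, hx, hxu⟩
    obtain ⟨v, hv⟩ := hu u
    refine ⟨x * (v⁻¹ : Rˣ), ?_, ?_⟩
    · rw [hx, Ideal.span_singleton_mul_right_unit (Units.isUnit _)]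
    · rw [map_mul, hxu, ← hv, mul_assoc, ← map_mul, Units.mul_inv, map_one, mul_one]
  · rintro ⟨x, hx, hxh⟩
    exact ⟨x, 1, hx, by rw [Units.val_one, map_one, mul_one, hxh]⟩

/-- The homomorphism that sends `(I, x)` to the class of the module that glues `I` and `S` along
`f x`, in the kernel of the projection to the Picard group of `S`. -/
def kernelClass :
    invertibleIdeals f × unitsComap f →* (Pic.mapRingHom (fiberSnd f g)).ker :=
  ((glueClass hf hg).comp (.prodMap (.id _) ((MonoidHom.inr (invertibleIdeals g) _).comp
    (mapUnitsComap f)))).codRestrict _ fun _ ↦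
      (mapRingHom_fiberSnd_glueClass hf hg _).trans (map_one _)

theorem coe_kernelClass (a : invertibleIdeals f × unitsComap f) :
    (kernelClass hf hg a : Pic (fiberProduct f g)) =
      glueClass hf hg (a.1, 1, mapUnitsComap f a.2) := rfl

theorem kernelClass_surjective [IsLocalRing k] (hfr : ∀ s, IsUnit (f s) → s ∈ R⁰)
    (hgr : ∀ s, IsUnit (g s) → s ∈ S⁰) : Function.Surjective (kernelClass hf hg) := by
  rintro ⟨X, hX⟩
  obtain ⟨I, h, rfl⟩ := (mem_ker_mapRingHom_fiberSnd_iff hf hg hfr hgr).1 hX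
  obtain ⟨x, hx⟩ := hf h
  have hxu : IsUnit (f x) := hx ▸ h.isUnit
  have hxh : mapUnitsComap f ⟨x, hxu⟩ = h := Units.ext hx
  exact ⟨(I, ⟨x, hxu⟩), Subtype.ext (by rw [coe_kernelClass, hxh])⟩

theorem kernelClass_eq_one_iff (hu : ∀ u : Sˣ, ∃ v : Rˣ, f v = g u) {I : invertibleIdeals f}
    {x : unitsComap f} : kernelClass hf hg (I, x) = 1 ↔
      ∃ a, I.1 = Ideal.span {a} ∧ f a = mapUnitsComap f x := by
  rw [← glueClass_one_eq_one_iff_exists_generator hf hg hu, ← OneMemClass.coe_eq_one,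
    coe_kernelClass]

theorem exists_splitting [IsLocalRing k] (hgr : ∀ s, IsUnit (g s) → s ∈ S⁰)
    (n : invertibleIdeals g →* invertibleIdeals f)
    (hn : ∀ J y, J.1 = Ideal.span {y} → ∃ x, (n J).1 = Ideal.span {x} ∧ f x = g y) :
    ∃ ψ : Pic S →* Pic (fiberProduct f g),
      ∀ J, ψ (idealClass g J) = glueClass hf hg (n J, J, 1) := by
  obtain ⟨ψ, hψ⟩ := exists_comp_eq_of_surjective (idealClass_surjective hgr)
    (v := (glueClass hf hg).comp (n.prod ((MonoidHom.id _).prod 1))) fun J hJ ↦ by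
      obtain ⟨y, hy⟩ := idealClass_eq_one_iff.1 hJ
      obtain ⟨x, hx, hxy⟩ := hn J y hy
      exact (glueClass_eq_one_iff hf hg).2 ⟨x, y, hx, hy, by rw [hxy]; simp⟩
  exact ⟨ψ, fun J ↦ DFunLike.congr_fun hψ J⟩

end Glue

/-! ### The norm of a radical extension in characteristic `p` -/

section RadicalNorm

open Polynomial

theorem map_aeval_int {R S : Type*} [Ring R] [Ring S] [Algebra ℤ R] [Algebra ℤ S] (f : R →+* S)
    (a : R) (P : ℤ[X]) : f (aeval a P) = aeval (f a) P := by
  simpa only [map_id] using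
    map_aeval_eq_aeval_map (φ := RingHom.id ℤ) (ψ := f) (RingHom.ext_int _ _) P a

variable {R : Type*} [CommRing R] {n p : ℕ}

/-- The companion matrix of `X ^ n - z`. -/
def radicalMatrix (n : ℕ) (z : R) : Matrix (Fin n) (Fin n) R :=
  .of fun i j ↦ if (i : ℕ) = j + 1 then 1 else if (i : ℕ) + n = j + 1 then z else 0

theorem map_radicalMatrix {S : Type*} [CommRing S] (f : R →+* S) (z : R) :
    f.mapMatrix (radicalMatrix n z) = radicalMatrix n (f z) := by
  ext i j
  simp only [radicalMatrix, RingHom.mapMatrix_apply, Matrix.map_apply, Matrix.of_apply, apply_ite f,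
    map_one, map_zero]

theorem leftMulMatrix_eq_radicalMatrix {S : Type*} [CommRing S] [Algebra R S] {z : R} {t : S}
    (ht : t ^ n = algebraMap R S z) (b : Module.Basis (Fin n) R S)
    (hb : ∀ i, b i = t ^ (i : ℕ)) : Algebra.leftMulMatrix b t = radicalMatrix n z := by
  ext i j
  rw [Algebra.leftMulMatrix_eq_repr_mul, hb, ← pow_succ', radicalMatrix, Matrix.of_apply]
  rcases (Nat.succ_le_of_lt j.2).eq_or_lt with hj | hj
  · have hpow : t ^ ((j : ℕ) + 1) = z • b ⟨0, j.pos⟩ := by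
      rw [show (j : ℕ) + 1 = n from hj, ht, hb, pow_zero, Algebra.algebraMap_eq_smul_one]
    rw [hpow, map_smul, b.repr_self, if_neg (by omega), Finsupp.smul_apply, Finsupp.single_apply,
      smul_eq_mul, mul_ite, mul_one, mul_zero]
    exact if_congr (by rw [Fin.ext_iff]; simp only; omega) rfl rfl
  · rw [← hb ⟨j + 1, hj⟩, b.repr_self, if_neg (c := (i : ℕ) + n = j + 1) (by omega),
      Finsupp.single_apply]
    exact if_congr (by rw [Fin.ext_iff, eq_comm]) rfl rfl

theorem radicalMatrix_pow (hn : n ≠ 0) (z : R) :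
    radicalMatrix n z ^ n = algebraMap R (Matrix (Fin n) (Fin n) R) z := by
  nontriviality R
  let pb := AdjoinRoot.powerBasis' (monic_X_pow_sub_C z hn)
  let b := pb.basis.reindex (finCongr (natDegree_X_pow_sub_C (r := z) (n := n)))
  have hroot : AdjoinRoot.root (X ^ n - C z) ^ n = algebraMap R _ z := by
    have h := AdjoinRoot.eval₂_root (X ^ n - C z)
    rwa [eval₂_sub, eval₂_X_pow, eval₂_C, sub_eq_zero] at h
  have hb (i : Fin n) : b i = AdjoinRoot.root (X ^ n - C z) ^ (i : ℕ) := by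
    rw [Module.Basis.reindex_apply, pb.basis_eq_pow]
    rfl
  rw [← leftMulMatrix_eq_radicalMatrix hroot b hb, ← map_pow, hroot, AlgHom.commutes]

/-- The norm form of the radical extension `R[t] / (t ^ n - z)` at the element `P(t)`. -/
def radicalNorm (n : ℕ) (z : R) (P : ℤ[X]) : R :=
  (aeval (radicalMatrix n z) P).det

theorem map_radicalNorm {S : Type*} [CommRing S] (f : R →+* S) (z : R) (P : ℤ[X]) :
    f (radicalNorm n z P) = radicalNorm n (f z) P := by
  rw [radicalNorm, RingHom.map_det, map_aeval_int, map_radicalMatrix, radicalNorm]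

theorem norm_aeval_eq_radicalNorm {S : Type*} [CommRing S] [Algebra R S] {z : R} {t : S}
    (ht : t ^ n = algebraMap R S z) (b : Module.Basis (Fin n) R S)
    (hb : ∀ i, b i = t ^ (i : ℕ)) (P : ℤ[X]) :
    Algebra.norm R (aeval t P) = radicalNorm n z P := by
  rw [Algebra.norm_eq_matrix_det b, radicalNorm, ← leftMulMatrix_eq_radicalMatrix ht b hb]
  exact congrArg Matrix.det (map_aeval_int (Algebra.leftMulMatrix b).toRingHom t P)

theorem aeval_pow_char {S : Type*} [Ring S] [Algebra ℤ S] [Algebra (ZMod p) S] [Fact p.Prime]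
    (a : S) (P : ℤ[X]) : aeval a P ^ p = aeval (a ^ p) P := by
  have hmod (x : S) : aeval x P = aeval x (P.map (Int.castRingHom (ZMod p))) :=
    map_aeval_eq_aeval_map (ψ := RingHom.id S) (RingHom.ext_int _ _) P x
  rw [hmod, hmod, ← map_pow, ← ZMod.expand_card, expand_aeval]

/-- In characteristic `p` the element `P(t) ^ p = P(z)` of `R[t] / (t ^ p - z)` is a scalar. -/
theorem radicalNorm_pow [Fact p.Prime] [CharP R p] (z : R) (P : ℤ[X]) :
    radicalNorm p z P ^ p = aeval z P ^ p := by
  let _ := ZMod.algebra R p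
  rw [radicalNorm, ← Matrix.det_pow, aeval_pow_char (radicalMatrix p z),
    radicalMatrix_pow (Fact.out : p.Prime).ne_zero]
  have h := map_aeval_int (algebraMap R (Matrix (Fin p) (Fin p) R)) z P
  rw [← h, Matrix.algebraMap_eq_diagonal, Matrix.det_diagonal]
  simp

theorem radicalNorm_eq_aeval [Algebra ℤ R] [Fact p.Prime] (hp : (p : R) = 0) (z : R) (P : ℤ[X]) :
    radicalNorm p z P = aeval z P := by
  nontriviality R
  have : CharP R p := (CharP.charP_iff_prime_eq_zero Fact.out).2 hp
  -- The identity only involves `z`, so it may be checked in the domain `𝔽_p[X]`.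
  have huniv : radicalNorm p (X : (ZMod p)[X]) P = aeval X P :=
    frobenius_inj (ZMod p)[X] p (radicalNorm_pow X P)
  have h := congrArg (eval₂RingHom (ZMod.castHom dvd_rfl R) z) huniv
  rwa [map_radicalNorm, map_aeval_int, coe_eval₂RingHom, eval₂_X] at h

end RadicalNorm

/-! ### Reduction modulo `p` in the two cyclotomic rings -/

section Cyclotomic

open Polynomial

theorem isUnit_aeval_iff {R : Type*} [CommRing R] [Nontrivial R] [Algebra ℤ R] {p k : ℕ}
    [Fact p.Prime] (hp : (p : R) = 0) {z : R} (hz : z ^ p ^ k = 1) (P : ℤ[X]) :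
    IsUnit (aeval z P) ↔ ¬ (p : ℤ) ∣ P.eval 1 := by
  have : CharP R p := (CharP.charP_iff_prime_eq_zero Fact.out).2 hp
  have hz1 : IsNilpotent (z - 1) := ⟨p ^ k, by rw [sub_pow_char_pow, hz, one_pow, sub_self]⟩
  have hdvd : z - 1 ∣ aeval z P - (P.eval 1 : ℤ) := by
    have h := (P.map (Int.castRingHom R)).sub_dvd_eval_sub z 1
    rwa [eval_map, eval_map, eval₂_at_one, RingHom.ext_int (Int.castRingHom R) (algebraMap ℤ R),
      ← aeval_def, eq_intCast] at h
  have hnil : IsNilpotent (aeval z P - (P.eval 1 : ℤ)) := by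
    obtain ⟨c, hc⟩ := hdvd
    exact hc ▸ (Commute.all _ _).isNilpotent_mul_right hz1
  rw [← CharP.isUnit_intCast_iff (R := R) Fact.out]
  constructor
  · intro h
    simpa using hnil.neg.isUnit_add_left_of_commute h (Commute.all _ _)
  · intro h
    simpa using hnil.isUnit_add_left_of_commute h (Commute.all _ _)

theorem isCoprime_iff_exists_isUnit_mk {R : Type*} [CommRing R] {I J : Ideal R} :
    IsCoprime I J ↔ ∃ a ∈ I, IsUnit (Ideal.Quotient.mk J a) := by
  rw [Ideal.isCoprime_iff_exists]
  constructor
  · rintro ⟨a, ha, b, hb, hab⟩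
    refine ⟨a, ha, ?_⟩
    rw [← sub_eq_iff_eq_add.2 hab.symm, map_sub, map_one, Ideal.Quotient.eq_zero_iff_mem.2 hb,
      sub_zero]
    exact isUnit_one
  · rintro ⟨a, ha, hu⟩
    obtain ⟨c, hc⟩ := hu.exists_left_inv
    obtain ⟨y, rfl⟩ := Ideal.Quotient.mk_surjective c
    rw [← map_mul, ← map_one (Ideal.Quotient.mk J), Ideal.Quotient.eq] at hc
    exact ⟨y * a, I.mul_mem_left _ ha, 1 - y * a, by rw [← neg_sub]; exact neg_mem hc, by ring⟩

theorem natCast_quotient_pIdeal (p : ℕ) (R : Type*) [CommRing R] : (p : R ⧸ pIdeal p R) = 0 := by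
  rw [← map_natCast (Ideal.Quotient.mk (pIdeal p R)), Ideal.Quotient.eq_zero_iff_mem]
  exact Ideal.mem_span_singleton_self _

theorem j₁_surjective (p : ℕ) (K : Type*) [Field K] [NumberField K] :
    Function.Surjective (j₁ p K) :=
  Ideal.Quotient.mk_surjective

variable {p : ℕ} [Fact p.Prime] {K : Type*} [Field K] [NumberField K]
  {L : Type*} [Field L] [NumberField L]

instance : Nontrivial (F p K) := by
  refine Ideal.Quotient.nontrivial_iff.2 fun h ↦ ?_
  have hbot : PrimeTo p (⊥ : Ideal (𝓞 K)) := by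
    rw [PrimeTo, h, ← Ideal.one_eq_top]
    exact isCoprime_one_right
  exact hbot.ne_zero FractionalIdeal.coeIdeal_bot

theorem exists_aeval_toInteger {n : ℕ} [NeZero n] [IsCyclotomicExtension {n} ℚ K] {ζ : K}
    (h : IsPrimitiveRoot ζ n) (x : 𝓞 K) : ∃ P : ℤ[X], aeval h.toInteger P = x := by
  obtain ⟨P, hP⟩ := h.integralPowerBasis.exists_eq_aeval' x
  exact ⟨P, by rw [hP, h.integralPowerBasis_gen]⟩

theorem isUnit_j₁_aeval_iff {k : ℕ} {z : 𝓞 K} (hz : z ^ p ^ k = 1) (P : ℤ[X]) :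
    IsUnit (j₁ p K (aeval z P)) ↔ ¬ (p : ℤ) ∣ P.eval 1 := by
  rw [map_aeval_int]
  exact isUnit_aeval_iff (natCast_quotient_pIdeal p _) (by rw [← map_pow, hz, map_one]) P

theorem isLocalRing_F [IsCyclotomicExtension {p} ℚ K] {ζ₁ : K} (h₁ : IsPrimitiveRoot ζ₁ p) :
    IsLocalRing (F p K) := by
  refine .of_isUnit_or_isUnit_one_sub_self fun a ↦ ?_
  obtain ⟨x, rfl⟩ := j₁_surjective p K a
  obtain ⟨P, rfl⟩ := exists_aeval_toInteger h₁ x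
  have hz : h₁.toInteger ^ p ^ 1 = 1 := by
    rw [pow_one, h₁.toInteger_isPrimitiveRoot.pow_eq_one]
  have hsub : 1 - j₁ p K (aeval h₁.toInteger P) = j₁ p K (aeval h₁.toInteger (1 - P)) := by
    simp only [map_sub, map_one]
  rw [hsub, isUnit_j₁_aeval_iff hz, isUnit_j₁_aeval_iff hz, ← not_and_or, eval_sub, eval_one]
  rintro ⟨h, h'⟩
  exact (Nat.prime_iff_prime_int.1 (Fact.out : p.Prime)).not_dvd_one
    ((dvd_sub_left h).1 h')

variable {ζ₁ : K} (h₁ : IsPrimitiveRoot ζ₁ p) {ζ₂ : L} (h₂ : IsPrimitiveRoot ζ₂ (p ^ 2))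
  [IsCyclotomicExtension {p ^ 2} ℚ L]

theorem j₂_aeval (P : ℤ[X]) :
    j₂ h₁ h₂ (aeval h₂.toInteger P) = j₁ p K (aeval h₁.toInteger P) := by
  rw [map_aeval_int, map_aeval_int, j₂_toInteger]

theorem isUnit_mk_iff_isUnit_j₂ (x : 𝓞 L) :
    IsUnit (Ideal.Quotient.mk (pIdeal p (𝓞 L)) x) ↔ IsUnit (j₂ h₁ h₂ x) := by
  obtain ⟨P, rfl⟩ := exists_aeval_toInteger h₂ x
  rw [j₂_aeval, isUnit_j₁_aeval_iff (k := 2) h₂.toInteger_isPrimitiveRoot.pow_eq_one,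
    isUnit_j₁_aeval_iff (k := 1) (by rw [pow_one, h₁.toInteger_isPrimitiveRoot.pow_eq_one])]

theorem primeTo_iff_mem_invertibleIdeals_j₁ {I : Ideal (𝓞 K)} :
    PrimeTo p I ↔ I ∈ invertibleIdeals (j₁ p K) :=
  isCoprime_iff_exists_isUnit_mk.trans mem_invertibleIdeals_iff.symm

theorem primeTo_iff_mem_invertibleIdeals_j₂ {I : Ideal (𝓞 L)} :
    PrimeTo p I ↔ I ∈ invertibleIdeals (j₂ h₁ h₂) := by
  simp only [PrimeTo, isCoprime_iff_exists_isUnit_mk, mem_invertibleIdeals_iff,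
    isUnit_mk_iff_isUnit_j₂ h₁ h₂]

variable [IsCyclotomicExtension {p} ℚ K]

theorem j₂_surjective : Function.Surjective (j₂ h₁ h₂) := by
  intro c
  obtain ⟨x, rfl⟩ := j₁_surjective p K c
  obtain ⟨P, rfl⟩ := exists_aeval_toInteger h₁ x
  exact ⟨aeval h₂.toInteger P, j₂_aeval h₁ h₂ P⟩

variable [Algebra K L]

variable (p K L) in
theorem finrank_cyclotomic_tower : Module.finrank K L = p := by
  have hp := (Fact.out : p.Prime)
  have h := Module.finrank_mul_finrank ℚ K L
  rw [IsCyclotomicExtension.finrank (n := p) K (cyclotomic.irreducible_rat hp.pos),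
    IsCyclotomicExtension.finrank (n := p ^ 2) L (cyclotomic.irreducible_rat (pow_pos hp.pos 2)),
    Nat.totient_prime hp, Nat.totient_prime_pow hp two_pos, mul_comm] at h
  simpa only [Nat.reduceSub, pow_one] using
    Nat.eq_of_mul_eq_mul_right (Nat.sub_pos_of_lt hp.one_lt) h

include h₂ in
variable (K) in
theorem exists_basis_eq_pow : ∃ b : Module.Basis (Fin p) K L, ∀ i, b i = ζ₂ ^ (i : ℕ) := by
  have hadj : Algebra.adjoin K {ζ₂} = ⊤ := by
    rw [← Algebra.adjoin_adjoin_of_tower ℚ,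
      IsCyclotomicExtension.adjoin_primitive_root_eq_top (A := ℚ) h₂, Algebra.coe_top,
      Algebra.adjoin_univ]
  let pb := PowerBasis.ofAdjoinEqTop' (Algebra.IsIntegral.isIntegral (R := K) ζ₂) hadj
  have hdim : pb.dim = p := by rw [← pb.finrank, finrank_cyclotomic_tower p K L]
  refine ⟨pb.basis.reindex (finCongr hdim), fun i ↦ ?_⟩
  rw [Module.Basis.reindex_apply, pb.basis_eq_pow, PowerBasis.ofAdjoinEqTop'_gen]
  rfl

theorem j₁_intNorm (hζ : algebraMap K L ζ₁ = ζ₂ ^ p) (x : 𝓞 L) :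
    j₁ p K (Algebra.intNorm (𝓞 K) (𝓞 L) x) = j₂ h₁ h₂ x := by
  obtain ⟨P, rfl⟩ := exists_aeval_toInteger h₂ x
  obtain ⟨b, hb⟩ := exists_basis_eq_pow K h₂
  have hnorm : Algebra.intNorm (𝓞 K) (𝓞 L) (aeval h₂.toInteger P) =
      radicalNorm p h₁.toInteger P := by
    refine RingOfIntegers.coe_injective (K := K) ?_
    rw [map_radicalNorm]
    calc algebraMap (𝓞 K) K (Algebra.intNorm (𝓞 K) (𝓞 L) (aeval h₂.toInteger P))
      _ = Algebra.norm K (algebraMap (𝓞 L) L (aeval h₂.toInteger P)) :=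
        Algebra.algebraMap_intNorm ..
      _ = Algebra.norm K (aeval ζ₂ P) := by rw [map_aeval_int]; rfl
      _ = radicalNorm p ζ₁ P := norm_aeval_eq_radicalNorm hζ.symm b hb P
  rw [hnorm, map_radicalNorm, radicalNorm_eq_aeval (natCast_quotient_pIdeal p _), j₂_aeval,
    map_aeval_int]

end Cyclotomic

/-! ### The integral group ring as a fibre product -/

section ToFiberProduct

variable {T R S k : Type*} [CommRing T] [CommRing R] [CommRing S] [CommRing k]
  {f : R →+* k} {g : S →+* k}

/-- The homomorphism to a fibre product given by two homomorphisms that agree over `k`. -/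
def toFiberProduct (u : T →+* R) (v : T →+* S) (huv : f.comp u = g.comp v) :
    T →+* fiberProduct f g :=
  (u.prod v).codRestrict _ fun t ↦ DFunLike.congr_fun huv t

theorem toFiberProduct_bijective {u : T →+* R} {v : T →+* S} (huv : f.comp u = g.comp v)
    (hv : Function.Surjective v) (hinj : ∀ t, u t = 0 → v t = 0 → t = 0)
    (hlift : ∀ x, f x = 0 → ∃ t, u t = x ∧ v t = 0) :
    Function.Bijective (toFiberProduct u v huv) := by
  constructor
  · refine (injective_iff_map_eq_zero _).2 fun t ht ↦ ?_
    have ht' : (u t, v t) = 0 := congrArg Subtype.val ht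
    exact hinj t (congrArg Prod.fst ht') (congrArg Prod.snd ht')
  · rintro ⟨⟨x, y⟩, hxy⟩
    obtain ⟨t, rfl⟩ := hv y
    obtain ⟨s, hs, hs'⟩ := hlift (x - u t) (by
      rw [map_sub, mem_fiberProduct.1 hxy, sub_eq_zero]
      exact (DFunLike.congr_fun huv t).symm)
    have hx : u (t + s) = x := by rw [map_add, hs, add_sub_cancel]
    have hy : v (t + s) = v t := by rw [map_add, hs', add_zero]
    exact ⟨t + s, Subtype.ext (Prod.ext hx hy)⟩

theorem mapRingHom_bijective_of_bijective {R S : Type*} [CommRing R] [CommRing S] {f : R →+* S}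
    (hf : Function.Bijective f) : Function.Bijective (Pic.mapRingHom f) := by
  let e := RingEquiv.ofBijective f hf
  refine Function.bijective_iff_has_inverse.2 ⟨Pic.mapRingHom (e.symm : S →+* R), fun X ↦ ?_,
    fun X ↦ ?_⟩
  · rw [Pic.mapRingHom_mapRingHom, show (e.symm : S →+* R).comp f = .id R from
      RingHom.ext e.symm_apply_apply, Pic.mapRingHom_id_apply]
  · rw [Pic.mapRingHom_mapRingHom, show f.comp (e.symm : S →+* R) = .id S from
      RingHom.ext e.apply_symm_apply, Pic.mapRingHom_id_apply]

end ToFiberProduct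

section GroupRing

open Polynomial

theorem geom_sum_mul_geom_sum_pow_eq_one {R : Type*} [CommRing R] {a : R} {n r s : ℕ}
    (ha : a ^ n = 1) (hreg : a - 1 ∈ R⁰) (hrs : r * s ≡ 1 [MOD n]) :
    (∑ i ∈ Finset.range r, a ^ i) * ∑ i ∈ Finset.range s, (a ^ r) ^ i = 1 := by
  refine (mul_cancel_left_mem_nonZeroDivisors hreg).1 ?_
  rw [← mul_assoc, mul_geom_sum, mul_geom_sum, ← pow_mul, pow_eq_pow_of_modEq hrs ha, mul_one,
    pow_one]

theorem cyclotomic_mul_cyclotomic_dvd {m n : ℕ} (hmn : m ≠ n) {P : ℤ[X]}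
    (hm : cyclotomic m ℤ ∣ P) (hn : cyclotomic n ℤ ∣ P) :
    cyclotomic m ℤ * cyclotomic n ℤ ∣ P := by
  have hprim (k : ℕ) : (cyclotomic k ℤ).IsPrimitive := (cyclotomic.monic k ℤ).isPrimitive
  rw [IsPrimitive.Int.dvd_iff_map_cast_dvd_map_cast _ _ (hprim _)] at hm hn
  rw [IsPrimitive.Int.dvd_iff_map_cast_dvd_map_cast _ _ ((hprim m).mul (hprim n)),
    Polynomial.map_mul]
  refine IsCoprime.mul_dvd ?_ hm hn
  rw [map_cyclotomic, map_cyclotomic]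
  exact cyclotomic.isCoprime_rat hmn

variable {p : ℕ} [Fact p.Prime]

variable (p) in
theorem isLocalRing_zmod_pow {k : ℕ} (hk : k ≠ 0) : IsLocalRing (ZMod (p ^ k)) :=
  have : Fact (1 < p ^ k) := ⟨Nat.one_lt_pow hk (Fact.out : p.Prime).one_lt⟩
  .of_surjective' (PadicInt.toZModPow k) (ZMod.ringHom_surjective _)

variable (p) in
theorem eval_one_cyclotomic_mul_cyclotomic_sq :
    (cyclotomic p ℤ * cyclotomic (p ^ 2) ℤ).eval 1 = ((p ^ 2 : ℕ) : ℤ) := by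
  have hsq : eval 1 (cyclotomic (p ^ 2) ℤ) = (p : ℤ) := eval_one_cyclotomic_prime_pow 1
  rw [eval_mul, eval_one_cyclotomic_prime, hsq, Nat.cast_pow, sq]

variable (p) in
theorem cyclotomic_mul_cyclotomic_sq_mul_X_sub_one :
    cyclotomic p ℤ * cyclotomic (p ^ 2) ℤ * (X - 1) = X ^ p ^ 2 - 1 := by
  have h := cyclotomic_prime_pow_mul_X_pow_sub_one ℤ p 1
  rw [pow_one, ← cyclotomic_prime_mul_X_sub_one ℤ p] at h
  rw [← h]
  ring

theorem aeval_toInteger_eq_zero_iff {n : ℕ} [NeZero n] {K : Type*} [Field K] [CharZero K] {ζ : K}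
    (h : IsPrimitiveRoot ζ n) {P : ℤ[X]} : aeval h.toInteger P = 0 ↔ cyclotomic n ℤ ∣ P := by
  rw [cyclotomic_eq_minpoly h (NeZero.pos n),
    ← minpoly.isIntegrallyClosed_dvd_iff (h.isIntegral (NeZero.pos n)),
    ← RingOfIntegers.coe_injective.eq_iff, map_zero, map_aeval_int]
  rfl

variable (p) in
/-- The generator of the cyclic group, as an element of its group ring. -/
def gen : GroupRing p := MonoidAlgebra.of ℤ _ (Multiplicative.ofAdd 1)

variable (p) in
/-- The augmentation of the group ring. -/
def aug : GroupRing p →+* ℤ :=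
  (MonoidAlgebra.lift ℤ ℤ (Multiplicative (ZMod (p ^ 2))) 1).toRingHom

variable (p) in
omit [Fact p.Prime] in
theorem gen_pow : gen p ^ p ^ 2 = 1 := by
  rw [gen, ← map_pow, ← ofAdd_nsmul, nsmul_one, ZMod.natCast_self, ofAdd_zero, map_one]

omit [Fact p.Prime] in
theorem aug_aeval_gen (P : ℤ[X]) : aug p (aeval (gen p) P) = P.eval 1 := by
  have hgen : aug p (gen p) = 1 := by simp [aug, gen]
  rw [map_aeval_int, hgen, coe_aeval_eq_eval]

theorem exists_aeval_gen (x : GroupRing p) : ∃ P : ℤ[X], aeval (gen p) P = x := by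
  induction x using MonoidAlgebra.induction_on with
  | of m =>
    refine ⟨X ^ (Multiplicative.toAdd m).val, ?_⟩
    rw [aeval_X_pow, gen, ← map_pow, ← ofAdd_nsmul, nsmul_one, ZMod.natCast_zmod_val, ofAdd_toAdd]
  | add x y hx hy =>
    obtain ⟨P, rfl⟩ := hx
    obtain ⟨Q, rfl⟩ := hy
    exact ⟨P + Q, map_add _ _ _⟩
  | smul n x hx =>
    obtain ⟨P, rfl⟩ := hx
    exact ⟨n • P, map_smul _ _ _⟩

variable {K : Type*} [Field K] [NumberField K] {L : Type*} [Field L] [NumberField L]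
  [IsCyclotomicExtension {p ^ 2} ℚ L] {ζ₁ : K} (h₁ : IsPrimitiveRoot ζ₁ p) {ζ₂ : L}
  (h₂ : IsPrimitiveRoot ζ₂ (p ^ 2))

theorem groupRingToA_gen : groupRingToA h₁ h₂ (gen p) = zetaPair h₁ h₂ := by
  have hval : (1 : ZMod (p ^ 2)).val = 1 :=
    ZMod.val_one'' (Nat.one_lt_pow two_ne_zero (Fact.out : p.Prime).one_lt).ne'
  simp [groupRingToA, gen, cyclicHom, hval]

theorem groupRingToA_aeval_gen (P : ℤ[X]) :
    (groupRingToA h₁ h₂ (aeval (gen p) P)).1 = (aeval h₁.toInteger P, aeval h₂.toInteger P) := by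
  rw [map_aeval_int, groupRingToA_gen]
  exact Prod.ext
    (map_aeval_int ((RingHom.fst (𝓞 K) (𝓞 L)).comp (A h₁ h₂).subtype) (zetaPair h₁ h₂) P)
    (map_aeval_int ((RingHom.snd (𝓞 K) (𝓞 L)).comp (A h₁ h₂).subtype) (zetaPair h₁ h₂) P)

theorem groupRingToA_aeval_gen_eq_zero_iff {P : ℤ[X]} :
    groupRingToA h₁ h₂ (aeval (gen p) P) = 0 ↔ cyclotomic p ℤ * cyclotomic (p ^ 2) ℤ ∣ P := by
  have hne : p ≠ p ^ 2 := (lt_self_pow₀ (Fact.out : p.Prime).one_lt one_lt_two).ne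
  rw [Subtype.ext_iff, groupRingToA_aeval_gen, ZeroMemClass.coe_zero, Prod.mk_eq_zero,
    aeval_toInteger_eq_zero_iff h₁, aeval_toInteger_eq_zero_iff h₂]
  exact ⟨fun h ↦ cyclotomic_mul_cyclotomic_dvd hne h.1 h.2,
    fun h ↦ ⟨dvd_of_mul_right_dvd h, dvd_of_mul_left_dvd h⟩⟩

theorem eq_zero_of_aug_of_groupRingToA {x : GroupRing p} (hx : aug p x = 0)
    (hx' : groupRingToA h₁ h₂ x = 0) : x = 0 := by
  obtain ⟨P, rfl⟩ := exists_aeval_gen x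
  obtain ⟨Q, rfl⟩ := (groupRingToA_aeval_gen_eq_zero_iff h₁ h₂).1 hx'
  rw [aug_aeval_gen, eval_mul, eval_one_cyclotomic_mul_cyclotomic_sq, mul_eq_zero] at hx
  have hQ : IsRoot Q 1 := hx.resolve_left
    (Nat.cast_ne_zero.2 (pow_ne_zero 2 (Fact.out : p.Prime).ne_zero))
  obtain ⟨S, rfl⟩ := dvd_iff_isRoot.2 hQ
  rw [C_1, ← mul_assoc, cyclotomic_mul_cyclotomic_sq_mul_X_sub_one, map_mul, map_sub, map_pow,
    aeval_X, map_one, gen_pow, sub_self, zero_mul]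

theorem exists_aug_eq_of_intCast_eq_zero {n : ℤ} (hn : (n : ZMod (p ^ 2)) = 0) :
    ∃ x : GroupRing p, aug p x = n ∧ groupRingToA h₁ h₂ x = 0 := by
  obtain ⟨c, rfl⟩ := (ZMod.intCast_zmod_eq_zero_iff_dvd n (p ^ 2)).1 hn
  refine ⟨aeval (gen p) (cyclotomic p ℤ * cyclotomic (p ^ 2) ℤ * C c), ?_,
    (groupRingToA_aeval_gen_eq_zero_iff h₁ h₂).2 (dvd_mul_right _ _)⟩
  rw [aug_aeval_gen, eval_mul, eval_one_cyclotomic_mul_cyclotomic_sq, eval_C]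

variable [IsCyclotomicExtension {p} ℚ K]

theorem groupRingToA_surjective : Function.Surjective (groupRingToA h₁ h₂) := by
  rintro ⟨⟨x, y⟩, hxy⟩
  obtain ⟨P, rfl⟩ := exists_aeval_toInteger h₂ y
  have hsub : j₁ p K x = j₁ p K (aeval h₁.toInteger P) :=
    ((mem_A h₁ h₂).1 hxy).trans (j₂_aeval h₁ h₂ P)
  obtain ⟨z, hz⟩ := Ideal.mem_span_singleton'.1 (Ideal.Quotient.eq.1 hsub)
  obtain ⟨Q, rfl⟩ := exists_aeval_toInteger h₁ z
  have hp : aeval h₁.toInteger (cyclotomic (p ^ 2) ℤ) = (p : 𝓞 K) := by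
    rw [cyclotomic_prime_pow_eq_geom_sum (Fact.out : p.Prime)]
    simp [h₁.toInteger_isPrimitiveRoot.pow_eq_one]
  refine ⟨aeval (gen p) (P + Q * cyclotomic (p ^ 2) ℤ), Subtype.ext ?_⟩
  rw [groupRingToA_aeval_gen, map_add, map_mul, hp, hz, add_sub_cancel, map_add, map_mul,
    (aeval_toInteger_eq_zero_iff h₂).2 dvd_rfl, mul_zero, add_zero]

/-- The homomorphism `A → ℤ / p ^ 2` induced by the augmentation, which sends `(ζ₁, ζ₂)` to `1`. -/
def augA : A h₁ h₂ →+* ZMod (p ^ 2) :=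
  (groupRingToA h₁ h₂).liftOfSurjective (groupRingToA_surjective h₁ h₂)
    ⟨(Int.castRingHom (ZMod (p ^ 2))).comp (aug p), fun x hx ↦ by
      obtain ⟨P, rfl⟩ := exists_aeval_gen x
      obtain ⟨Q, rfl⟩ := (groupRingToA_aeval_gen_eq_zero_iff h₁ h₂).1 hx
      rw [RingHom.mem_ker, RingHom.comp_apply, aug_aeval_gen, eval_mul,
        eval_one_cyclotomic_mul_cyclotomic_sq, map_mul, map_natCast, ZMod.natCast_self, zero_mul]⟩

theorem augA_comp_groupRingToA :
    (augA h₁ h₂).comp (groupRingToA h₁ h₂) = (Int.castRingHom (ZMod (p ^ 2))).comp (aug p) :=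
  RingHom.liftOfSurjective_comp _ _ _

theorem augA_groupRingToA_aeval_gen (P : ℤ[X]) :
    augA h₁ h₂ (groupRingToA h₁ h₂ (aeval (gen p) P)) = (P.eval 1 : ℤ) := by
  rw [← RingHom.comp_apply, augA_comp_groupRingToA, RingHom.comp_apply, aug_aeval_gen, eq_intCast]

theorem mem_nonZeroDivisors_of_isUnit_augA {a : A h₁ h₂} (ha : IsUnit (augA h₁ h₂ a)) :
    a ∈ (A h₁ h₂)⁰ := by
  obtain ⟨x, rfl⟩ := groupRingToA_surjective h₁ h₂ a
  obtain ⟨P, rfl⟩ := exists_aeval_gen x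
  rw [augA_groupRingToA_aeval_gen] at ha
  have hP : ¬ (p : ℤ) ∣ P.eval 1 := by
    have h := ha.map (ZMod.castHom (dvd_pow_self p two_ne_zero) (ZMod p))
    rwa [map_intCast, CharP.isUnit_intCast_iff (Fact.out : p.Prime)] at h
  have hu : IsUnit (j₁ p K (aeval h₁.toInteger P)) := (isUnit_j₁_aeval_iff (k := 1)
    (by rw [pow_one, h₁.toInteger_isPrimitiveRoot.pow_eq_one]) P).2 hP
  refine mem_nonZeroDivisors_fiberProduct ?_ ?_ <;> rw [groupRingToA_aeval_gen]
  · exact mem_nonZeroDivisors_of_isUnit_map hu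
  · exact mem_nonZeroDivisors_of_isUnit_map (f := j₂ h₁ h₂) (by rwa [j₂_aeval])

/-- The cyclotomic units `1 + ζ + ⋯ + ζ ^ (r - 1)` of `A` lift the units of `ℤ / p ^ 2`. -/
theorem exists_unit_augA_eq (h : (ZMod (p ^ 2))ˣ) : ∃ u : (A h₁ h₂)ˣ, augA h₁ h₂ u = h := by
  have hp := (Fact.out : p.Prime)
  have haug : augA h₁ h₂ (zetaPair h₁ h₂) = 1 := by
    simpa [groupRingToA_gen] using augA_groupRingToA_aeval_gen h₁ h₂ X
  have hreg : zetaPair h₁ h₂ - 1 ∈ (A h₁ h₂)⁰ := by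
    refine mem_nonZeroDivisors_fiberProduct (mem_nonZeroDivisors_of_ne_zero ?_)
      (mem_nonZeroDivisors_of_ne_zero ?_)
    · exact sub_ne_zero.2 (h₁.toInteger_isPrimitiveRoot.ne_one hp.one_lt)
    · exact sub_ne_zero.2
        (h₂.toInteger_isPrimitiveRoot.ne_one (Nat.one_lt_pow two_ne_zero hp.one_lt))
  have hmod : (h : ZMod (p ^ 2)).val * ((h⁻¹ : (ZMod (p ^ 2))ˣ) : ZMod (p ^ 2)).val ≡
      1 [MOD p ^ 2] := by
    rw [← ZMod.natCast_eq_natCast_iff, Nat.cast_mul, ZMod.natCast_zmod_val, ZMod.natCast_zmod_val,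
      Units.mul_inv, Nat.cast_one]
  refine ⟨.mkOfMulEqOne _ _
    (geom_sum_mul_geom_sum_pow_eq_one (zetaPair_pow h₁ h₂) hreg hmod), ?_⟩
  rw [Units.val_mkOfMulEqOne, map_sum]
  simp only [map_pow, haug, one_pow, Finset.sum_const, Finset.card_range, nsmul_eq_mul, mul_one,
    ZMod.natCast_zmod_val]

theorem mapRingHom_groupRingToA_bijective :
    Function.Bijective (Pic.mapRingHom (groupRingToA h₁ h₂)) := by
  have := isLocalRing_zmod_pow p two_ne_zero
  have huv := (augA_comp_groupRingToA h₁ h₂).symm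
  have hiso : Function.Bijective (toFiberProduct (aug p) (groupRingToA h₁ h₂) huv) :=
    toFiberProduct_bijective huv (groupRingToA_surjective h₁ h₂)
      (fun _ ↦ eq_zero_of_aug_of_groupRingToA h₁ h₂)
      fun _ ↦ exists_aug_eq_of_intCast_eq_zero h₁ h₂
  have hsnd : Function.Bijective
      (Pic.mapRingHom (fiberSnd (Int.castRingHom (ZMod (p ^ 2))) (augA h₁ h₂))) :=
    mapRingHom_fiberSnd_bijective ZMod.intCast_surjective (ZMod.ringHom_surjective _)
      (fun _ ↦ mem_nonZeroDivisors_of_isUnit_map)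
      (fun _ ↦ mem_nonZeroDivisors_of_isUnit_augA h₁ h₂) (exists_unit_augA_eq h₁ h₂)
  have hcomp := hsnd.comp (mapRingHom_bijective_of_bijective hiso)
  rwa [← MonoidHom.coe_comp, Pic.mapRingHom_comp_mapRingHom] at hcomp

end GroupRing

/-! ### The ray class group -/

theorem exists_span_eq_of_spanSingleton_eq {R K : Type*} [CommRing R] [IsDomain R] [Field K]
    [Algebra R K] [IsFractionRing R K] {I : Ideal R} {y : K}
    (h : FractionalIdeal.spanSingleton R⁰ y = I) :
    ∃ a, algebraMap R K a = y ∧ I = Ideal.span {a} := by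
  have hy : y ∈ (I : FractionalIdeal R⁰ K) := h ▸ FractionalIdeal.mem_spanSingleton_self _ _
  obtain ⟨a, -, rfl⟩ := (FractionalIdeal.mem_coeIdeal _).1 hy
  rw [← FractionalIdeal.coeIdeal_span_singleton] at h
  exact ⟨a, rfl, (FractionalIdeal.coeIdeal_injective h).symm⟩

section RayClassGroup

variable {p : ℕ} [Fact p.Prime] {K : Type*} [Field K] [NumberField K]

theorem coe_ne_zero_of_isUnit_j₁ {x : 𝓞 K} (hx : IsUnit (j₁ p K x)) : (x : K) ≠ 0 := by
  rw [RingOfIntegers.coe_ne_zero_iff]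
  rintro rfl
  exact hx.ne_zero (map_zero _)

theorem unit_mul_toPrincipalIdeal_eq_iff {x : 𝓞 K} {g : Kˣ} {I : Ideal (𝓞 K)}
    (hx : PrimeTo p (Ideal.span {x})) (hI : PrimeTo p I) :
    hx.unit * toPrincipalIdeal (𝓞 K) K g = hI.unit ↔
      FractionalIdeal.spanSingleton (𝓞 K)⁰ ((x : K) * g) = I := by
  rw [Units.ext_iff, Units.val_mul, coe_toPrincipalIdeal, PrimeTo.unit, PrimeTo.unit,
    Units.val_mk0, Units.val_mk0, FractionalIdeal.coeIdeal_span_singleton,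
    FractionalIdeal.spanSingleton_mul_spanSingleton]

theorem rayClass_span_eq_iff {x : 𝓞 K} {h : (F p K)ˣ} (hx : j₁ p K x = h) {I : Ideal (𝓞 K)}
    (hI : PrimeTo p I) :
    (primeTo_span hx).rayClass = hI.rayClass ↔ ∃ a, I = Ideal.span {a} ∧ j₁ p K a = h := by
  have hH : (primeTo_span hx).rayClass = hI.rayClass ↔
      ∃ g ∈ congrOne p K, (primeTo_span hx).unit * toPrincipalIdeal (𝓞 K) K g = hI.unit := by
    simp only [← eq_inv_mul_iff_mul_eq]
    exact QuotientGroup.eq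
  have hxu : IsUnit (j₁ p K x) := hx ▸ h.isUnit
  simp only [hH, unit_mul_toPrincipalIdeal_eq_iff]
  constructor
  · rintro ⟨g, ⟨u, v, hv, huv, hg⟩, hgI⟩
    obtain ⟨a, ha, rfl⟩ := exists_span_eq_of_spanSingleton_eq hgI
    have hav : a * v = x * u := RingOfIntegers.coe_injective <| by
      rw [map_mul, map_mul, ha, ← hg, mul_assoc]
    refine ⟨a, rfl, hv.mul_left_injective ?_⟩
    beta_reduce
    rw [← map_mul, hav, map_mul, huv, hx]
  · rintro ⟨a, rfl, ha⟩
    have hx0 := coe_ne_zero_of_isUnit_j₁ hxu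
    have ha0 : (a : K) ≠ 0 := coe_ne_zero_of_isUnit_j₁ (p := p) (ha ▸ h.isUnit)
    refine ⟨.mk0 ((a : K) / x) (div_ne_zero ha0 hx0),
      ⟨a, x, hxu, ha.trans hx.symm, div_mul_cancel₀ _ hx0⟩, ?_⟩
    rw [Units.val_mk0, mul_div_cancel₀ _ hx0, FractionalIdeal.coeIdeal_span_singleton]

variable (p K) in
/-- The homomorphism that sends an ideal prime to `p` to its class in the ray class group. -/
def rayClassHom : invertibleIdeals (j₁ p K) →* RayClassGroup p K where
  toFun I := (primeTo_iff_mem_invertibleIdeals_j₁.2 I.2).rayClass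
  map_one' := congrArg QuotientGroup.mk (Subtype.ext (Units.ext (by simp [PrimeTo.unit])))
  map_mul' I J := congrArg QuotientGroup.mk
    (Subtype.ext (Units.ext (by simp [PrimeTo.unit])))

theorem exists_rayClassHom_div_eq (c : RayClassGroup p K) :
    ∃ I J, rayClassHom p K I / rayClassHom p K J = c := by
  obtain ⟨⟨_, a, b, ha, hb, rfl⟩, rfl⟩ := QuotientGroup.mk_surjective c
  exact ⟨⟨a, primeTo_iff_mem_invertibleIdeals_j₁.1 ha⟩,
    ⟨b, primeTo_iff_mem_invertibleIdeals_j₁.1 hb⟩, rfl⟩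

variable (p K) in
/-- The homomorphism `(α, x) ↦ (x)⁻¹ α` to the ray class group. -/
def twistedRayClass : invertibleIdeals (j₁ p K) × unitsComap (j₁ p K) →* RayClassGroup p K where
  toFun a := rayClassHom p K a.1 / rayClassHom p K (principalIdeal (j₁ p K) a.2)
  map_one' := by
    rw [Prod.fst_one, Prod.snd_one, map_one (principalIdeal _)]
    exact div_self' _
  map_mul' a b := by
    simp only [Prod.fst_mul, Prod.snd_mul, map_mul]
    exact mul_div_mul_comm (α := RayClassGroup p K) _ _ _ _

theorem twistedRayClass_surjective : Function.Surjective (twistedRayClass p K) := fun c ↦ by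
  obtain ⟨I, ⟨J, hJ⟩, rfl⟩ := exists_rayClassHom_div_eq c
  obtain ⟨J', x, hJx, hx, hxu⟩ := id hJ
  have hJ' : J' ∈ invertibleIdeals (j₁ p K) := ⟨J, x, by rw [mul_comm, hJx], hx, hxu⟩
  refine ⟨(I * ⟨J', hJ'⟩, ⟨x, hxu⟩), ?_⟩
  have hx' : principalIdeal (j₁ p K) ⟨x, hxu⟩ = ⟨J, hJ⟩ * ⟨J', hJ'⟩ := Subtype.ext hJx.symm
  change rayClassHom p K _ / rayClassHom p K (principalIdeal _ _) = _
  rw [hx', map_mul, map_mul]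
  exact mul_div_mul_right_eq_div _ _ _

theorem twistedRayClass_eq_one_iff {I : invertibleIdeals (j₁ p K)} {x : unitsComap (j₁ p K)} :
    twistedRayClass p K (I, x) = 1 ↔
      ∃ a, I.1 = Ideal.span {a} ∧ j₁ p K a = mapUnitsComap (j₁ p K) x := by
  rw [← rayClass_span_eq_iff (h := mapUnitsComap (j₁ p K) x) rfl
    (primeTo_iff_mem_invertibleIdeals_j₁.2 I.2)]
  exact (div_eq_one (G := RayClassGroup p K)).trans eq_comm

end RayClassGroup

/-! ### The Picard group of `A` -/

section Main

variable {p : ℕ} [Fact p.Prime]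
  {K : Type*} [Field K] [NumberField K] [IsCyclotomicExtension {p} ℚ K]
  {L : Type*} [Field L] [NumberField L] [IsCyclotomicExtension {p ^ 2} ℚ L]
  {ζ₁ : K} (h₁ : IsPrimitiveRoot ζ₁ p) {ζ₂ : L} (h₂ : IsPrimitiveRoot ζ₂ (p ^ 2))

theorem invertible_M {α₁ : Ideal (𝓞 K)} {α₂ : Ideal (𝓞 L)} (h : (F p K)ˣ) (hα₁ : PrimeTo p α₁)
    (hα₂ : PrimeTo p α₂) : Module.Invertible (A h₁ h₂) (M h₁ h₂ α₁ α₂ h) :=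
  invertible_glue (j₁_surjective p K) (j₂_surjective h₁ h₂)
    (primeTo_iff_mem_invertibleIdeals_j₁.1 hα₁)
    ((primeTo_iff_mem_invertibleIdeals_j₂ h₁ h₂).1 hα₂) h

theorem isClassOf_M_iff {X : Pic (A h₁ h₂)} {a : invertibleIdeals (j₁ p K)}
    {b : invertibleIdeals (j₂ h₁ h₂)} {h : (F p K)ˣ} :
    IsClassOf h₁ h₂ X (M h₁ h₂ a b h) ↔
      glueClass (j₁_surjective p K) (j₂_surjective h₁ h₂) (a, b, h) = X :=
  (glueClass_eq_iff (a := (a, b, h)) (j₁_surjective p K) (j₂_surjective h₁ h₂)).symm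

theorem isClassOf_M_top_iff {X : Pic (A h₁ h₂)} {a : invertibleIdeals (j₁ p K)} {h : (F p K)ˣ} :
    IsClassOf h₁ h₂ X (M h₁ h₂ a ⊤ h) ↔
      glueClass (j₁_surjective p K) (j₂_surjective h₁ h₂) (a, 1, h) = X := by
  rw [← isClassOf_M_iff, ← Ideal.one_eq_top]
  rfl

theorem mem_B_iff {X : Pic (A h₁ h₂)} : X ∈ B h₁ h₂ ↔
    ∃ (α : Ideal (𝓞 K)) (h : (F p K)ˣ), PrimeTo p α ∧ IsClassOf h₁ h₂ X (M h₁ h₂ α ⊤ h) := by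
  have := isLocalRing_F h₁
  have hB : X ∈ B h₁ h₂ ↔
      ∃ a h, glueClass (j₁_surjective p K) (j₂_surjective h₁ h₂) (a, 1, h) = X :=
    mem_ker_mapRingHom_fiberSnd_iff (X := X) (j₁_surjective p K) (j₂_surjective h₁ h₂)
      (fun _ ↦ mem_nonZeroDivisors_of_isUnit_map) fun _ ↦ mem_nonZeroDivisors_of_isUnit_map
  simp only [hB, ← isClassOf_M_top_iff]
  constructor
  · rintro ⟨a, h, hX⟩
    exact ⟨a, h, primeTo_iff_mem_invertibleIdeals_j₁.2 a.2, hX⟩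
  · rintro ⟨α, h, hα, hX⟩
    exact ⟨⟨α, primeTo_iff_mem_invertibleIdeals_j₁.1 hα⟩, h, hX⟩

variable [Algebra K L]

theorem relNorm_mem_invertibleIdeals (hζ : algebraMap K L ζ₁ = ζ₂ ^ p) {J : Ideal (𝓞 L)}
    (hJ : J ∈ invertibleIdeals (j₂ h₁ h₂)) :
    Ideal.relNorm (𝓞 K) J ∈ invertibleIdeals (j₁ p K) := by
  obtain ⟨J', y, hJ', -, hu⟩ := hJ
  have hyu : IsUnit (j₁ p K (Algebra.intNorm (𝓞 K) (𝓞 L) y)) := by rwa [j₁_intNorm h₁ h₂ hζ]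
  exact ⟨Ideal.relNorm (𝓞 K) J', Algebra.intNorm (𝓞 K) (𝓞 L) y,
    by rw [← map_mul, hJ', Ideal.relNorm_singleton], mem_nonZeroDivisors_of_isUnit_map hyu, hyu⟩

theorem exists_equivPic_splitting (hζ : algebraMap K L ζ₁ = ζ₂ ^ p) :
    ∃ ψ : ClassGroup (𝓞 L) →* Pic (A h₁ h₂),
      (∀ α : (Ideal (𝓞 L))⁰, PrimeTo p (α : Ideal (𝓞 L)) →
        IsClassOf h₁ h₂ (ψ (ClassGroup.mk0 α)) (M h₁ h₂ (Ideal.relNorm (𝓞 K) α.1) α 1)) ∧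
      (Pic.mapRingHom (projTwo h₁ h₂)).comp ψ = (ClassGroup.equivPic (𝓞 L)).toMonoidHom := by
  have := isLocalRing_F h₁
  have hreg (s : 𝓞 L) (hs : IsUnit (j₂ h₁ h₂ s)) : s ∈ (𝓞 L)⁰ :=
    mem_nonZeroDivisors_of_isUnit_map hs
  let n : invertibleIdeals (j₂ h₁ h₂) →* invertibleIdeals (j₁ p K) :=
    ((Ideal.relNorm (𝓞 K)).toMonoidHom.comp (invertibleIdeals (j₂ h₁ h₂)).subtype).codRestrict _
      fun J ↦ relNorm_mem_invertibleIdeals h₁ h₂ hζ J.2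
  have hf := j₁_surjective p K
  have hg := j₂_surjective h₁ h₂
  obtain ⟨ψ, hψ⟩ := exists_splitting hf hg hreg n fun J y hJ ↦
    ⟨Algebra.intNorm (𝓞 K) (𝓞 L) y,
      (congrArg (Ideal.relNorm (𝓞 K)) hJ).trans (Ideal.relNorm_singleton _ y),
      j₁_intNorm h₁ h₂ hζ y⟩
  have hproj : (Pic.mapRingHom (projTwo h₁ h₂)).comp ψ = .id _ := MonoidHom.ext fun X ↦ by
    obtain ⟨J, rfl⟩ := idealClass_surjective hreg X
    exact (congrArg _ (hψ J)).trans (mapRingHom_fiberSnd_glueClass hf hg _)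
  refine ⟨ψ.comp (ClassGroup.equivPic (𝓞 L)).toMonoidHom, fun α hα ↦ ?_, ?_⟩
  · have hα' := (primeTo_iff_mem_invertibleIdeals_j₂ h₁ h₂).1 hα
    exact (isClassOf_M_iff h₁ h₂ (a := n ⟨α, hα'⟩) (b := ⟨α, hα'⟩)).2
      ((hψ ⟨α, hα'⟩).symm.trans (congrArg ψ (equivPic_mk0_eq_idealClass hα')).symm)
  · exact congrArg (MonoidHom.comp · (ClassGroup.equivPic (𝓞 L)).toMonoidHom) hproj

theorem exists_mulEquiv_rayClassGroup (hζ : algebraMap K L ζ₁ = ζ₂ ^ p) :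
    ∃ Θ : B h₁ h₂ ≃* RayClassGroup p K,
      ∀ (X : B h₁ h₂) (α : Ideal (𝓞 K)) (hα : PrimeTo p α) (h : (F p K)ˣ) (x : 𝓞 K)
        (hx : j₁ p K x = h), IsClassOf h₁ h₂ X (M h₁ h₂ α ⊤ h) →
          Θ X = (primeTo_span hx).rayClass⁻¹ * hα.rayClass := by
  have := isLocalRing_F h₁
  have hf := j₁_surjective p K
  have hg := j₂_surjective h₁ h₂
  have hu (u : (𝓞 L)ˣ) : ∃ v : (𝓞 K)ˣ, j₁ p K v = j₂ h₁ h₂ u :=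
    ⟨Units.map (Algebra.intNorm (𝓞 K) (𝓞 L)) u, j₁_intNorm h₁ h₂ hζ u⟩
  obtain ⟨Θ, hΘ⟩ := exists_mulEquiv_of_surjective
    (kernelClass_surjective hf hg (fun _ ↦ mem_nonZeroDivisors_of_isUnit_map)
      fun _ ↦ mem_nonZeroDivisors_of_isUnit_map) twistedRayClass_surjective fun a ↦
    (kernelClass_eq_one_iff hf hg hu).trans twistedRayClass_eq_one_iff.symm
  refine ⟨Θ, fun X α hα h x hx hX ↦ ?_⟩
  have hxu : IsUnit (j₁ p K x) := hx ▸ h.isUnit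
  have hxh : mapUnitsComap (j₁ p K) ⟨x, hxu⟩ = h := Units.ext hx
  have hα' := primeTo_iff_mem_invertibleIdeals_j₁.1 hα
  have hXa : kernelClass hf hg (⟨α, hα'⟩, ⟨x, hxu⟩) = X := Subtype.ext <| by
    rw [coe_kernelClass, hxh]
    exact (isClassOf_M_top_iff h₁ h₂ (a := ⟨α, hα'⟩)).1 hX
  exact (congrArg Θ hXa.symm).trans <|
    (hΘ _).trans (inv_mul_eq_div (α := RayClassGroup p K) _ _).symm

end Main

end CyclicPic

end

open CyclicPic in
theorem theorem2p1_general (p : ℕ) [Fact p.Prime]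
    (K : Type*) [Field K] [NumberField K] [IsCyclotomicExtension {p} ℚ K]
    (L : Type*) [Field L] [NumberField L] [IsCyclotomicExtension {p ^ 2} ℚ L]
    [Algebra K L] (ζ₁ : K) (h₁ : IsPrimitiveRoot ζ₁ p) (ζ₂ : L) (h₂ : IsPrimitiveRoot ζ₂ (p ^ 2))
    (hζ : algebraMap K L ζ₁ = ζ₂ ^ p) :
    Function.Bijective (Pic.mapRingHom (groupRingToA h₁ h₂)) ∧
    (∀ (α₁ : Ideal (𝓞 K)) (α₂ : Ideal (𝓞 L)) (h : (F p K)ˣ), PrimeTo p α₁ → PrimeTo p α₂ →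
      Module.Invertible (A h₁ h₂) (M h₁ h₂ α₁ α₂ h)) ∧
    (∃ ψ : ClassGroup (𝓞 L) →* Pic (A h₁ h₂),
      (∀ α : (Ideal (𝓞 L))⁰, PrimeTo p (α : Ideal (𝓞 L)) →
        IsClassOf h₁ h₂ (ψ (ClassGroup.mk0 α)) (M h₁ h₂ (Ideal.relNorm (𝓞 K) α.1) α 1)) ∧
      (Pic.mapRingHom (projTwo h₁ h₂)).comp ψ = (ClassGroup.equivPic (𝓞 L)).toMonoidHom ∧
      IsCompl ψ.range (B h₁ h₂)) ∧
    (∀ X : Pic (A h₁ h₂), X ∈ B h₁ h₂ ↔ ∃ (α : Ideal (𝓞 K)) (h : (F p K)ˣ), PrimeTo p α ∧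
      IsClassOf h₁ h₂ X (M h₁ h₂ α ⊤ h)) ∧
    ∃ Θ : B h₁ h₂ ≃* RayClassGroup p K,
      (∀ (X : B h₁ h₂) (α : Ideal (𝓞 K)) (hα : PrimeTo p α) (h : (F p K)ˣ) (x : 𝓞 K)
        (hx : j₁ p K x = h), IsClassOf h₁ h₂ X (M h₁ h₂ α ⊤ h) →
          Θ X = (primeTo_span hx).rayClass⁻¹ * hα.rayClass) ∧
      ∀ (P : Sylow p (B h₁ h₂)) (Q : Sylow p (RayClassGroup p K)),
        ∃ Θp : P ≃* Q, ∀ X : P, (Θp X : RayClassGroup p K) = Θ X := by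
  obtain ⟨ψ, hψ, hproj⟩ := exists_equivPic_splitting h₁ h₂ hζ
  obtain ⟨Θ, hΘ⟩ := exists_mulEquiv_rayClassGroup h₁ h₂ hζ
  have hbij : Function.Bijective ((Pic.mapRingHom (projTwo h₁ h₂)).comp ψ) :=
    hproj ▸ (ClassGroup.equivPic (𝓞 L)).bijective
  exact ⟨mapRingHom_groupRingToA_bijective h₁ h₂, fun _ _ h hα₁ hα₂ ↦ invertible_M h₁ h₂ h hα₁ hα₂,
    ⟨ψ, hψ, hproj, isCompl_range_ker hbij⟩, fun _ ↦ mem_B_iff h₁ h₂,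
    Θ, hΘ, fun P Q ↦ exists_sylow_mulEquiv (G' := RayClassGroup p K) Θ P Q⟩

open CyclicPic in
theorem theorem2p1 (p : ℕ) [Fact p.Prime] (hp : p ≠ 2)
    (K : Type*) [Field K] [NumberField K] [IsCyclotomicExtension {p} ℚ K]
    (L : Type*) [Field L] [NumberField L] [IsCyclotomicExtension {p ^ 2} ℚ L]
    [Algebra K L] (ζ₁ : K) (h₁ : IsPrimitiveRoot ζ₁ p) (ζ₂ : L) (h₂ : IsPrimitiveRoot ζ₂ (p ^ 2))
    (hζ : algebraMap K L ζ₁ = ζ₂ ^ p) :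
    -- `Pic ℤC ≅ Pic A` through the canonical map
    Function.Bijective (Pic.mapRingHom (groupRingToA h₁ h₂)) ∧
    -- the modules `M(α₁, α₂, h)` are invertible
    (∀ (α₁ : Ideal (𝓞 K)) (α₂ : Ideal (𝓞 L)) (h : (F p K)ˣ), PrimeTo p α₁ → PrimeTo p α₂ →
      Module.Invertible (A h₁ h₂) (M h₁ h₂ α₁ α₂ h)) ∧
    -- `α ↦ M(N α, α, 1)` splits the projection `Pic A → Cl ℤ[ζ₂]`, and `Pic A` is the direct
    -- product of its image and `B`
    (∃ ψ : ClassGroup (𝓞 L) →* Pic (A h₁ h₂),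
      (∀ α : (Ideal (𝓞 L))⁰, PrimeTo p (α : Ideal (𝓞 L)) →
        IsClassOf h₁ h₂ (ψ (ClassGroup.mk0 α)) (M h₁ h₂ (Ideal.relNorm (𝓞 K) α.1) α 1)) ∧
      (Pic.mapRingHom (projTwo h₁ h₂)).comp ψ = (ClassGroup.equivPic (𝓞 L)).toMonoidHom ∧
      IsCompl ψ.range (B h₁ h₂)) ∧
    -- `B` consists of the classes of the modules `M(α, ℤ[ζ₂], h)`
    (∀ X : Pic (A h₁ h₂), X ∈ B h₁ h₂ ↔ ∃ (α : Ideal (𝓞 K)) (h : (F p K)ˣ), PrimeTo p α ∧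
      IsClassOf h₁ h₂ X (M h₁ h₂ α ⊤ h)) ∧
    -- `M(α, ℤ[ζ₂], h) ↦ h⁻¹ α` is a well-defined isomorphism `B ≅ I₀(K) / H`, which restricts
    -- to an isomorphism of the Sylow `p`-subgroups
    ∃ Θ : B h₁ h₂ ≃* RayClassGroup p K,
      (∀ (X : B h₁ h₂) (α : Ideal (𝓞 K)) (hα : PrimeTo p α) (h : (F p K)ˣ) (x : 𝓞 K)
        (hx : j₁ p K x = h), IsClassOf h₁ h₂ X (M h₁ h₂ α ⊤ h) →
          Θ X = (primeTo_span hx).rayClass⁻¹ * hα.rayClass) ∧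
      ∀ (P : Sylow p (B h₁ h₂)) (Q : Sylow p (RayClassGroup p K)),
        ∃ Θp : P ≃* Q, ∀ X : P, (Θp X : RayClassGroup p K) = Θ X :=
  theorem2p1_general p K L ζ₁ h₁ ζ₂ h₂ hζ
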